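/- Let $k$ be a perfect field of characteristic $p>0$, let $S$ be a regular ring essentially of finite type over $k$, and let $R$ be a normal domain which is a quotient of $S$. Put $X=\operatorname{Spec} R$. Let $\pi\colon \widetilde X\to X$ be a proper birational morphism with $\widetilde X$ normal and integral, and let $K_{\widetilde X}$ and $K_X=\pi_*K_{\widetilde X}$ be (integral) canonical divisors; here a canonical divisor is the divisor of a nonzero rational top differential form over $k$. Let $\Delta$ be an effective $\mathbb Q$-Weil divisor on $X$ such that $K_X+\Delta$ is $\mathbb Q$-Cartier, that is, $m(K_X+\Delta)$ is an integral Cartier divisor for some integer $m>0$, and write $\pi^*(K_X+\Delta)=\frac1m\pi^*(m(K_X+\Delta))$. An ideal $I\subseteq R$ is called uniformly $(\Delta,F)$-compatible if for every $e>0$ and every $R$-linear map $\varphi\colon F^e_*R(\lceil (p^e-1)\Delta\rceil)\to R$ one has $\varphi(F^e_*I)\subseteq I$. Here $R(D)=\Gamma(X,\mathcal O_X(D))$, and $F^e_*M$ is $M$ with $r\in R$ acting as multiplication by $r^{p^e}$. The sheaves $\mathcal O_X(D)$ and $\pi_*\mathcal O_{\widetilde X}(D)$ are regarded as subsheaves of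 the constant sheaf of the common function field of $X$ and $\widetilde X$. Then: 1. If $G$ is an effective integral divisor on $\widetilde X$ such that $\pi_*\mathcal O_{\widetilde X}(\lceil K_{\widetilde X}-\pi^*(K_X+\Delta)\rceil+G)\subseteq\mathcal O_X$, then the ideal $\pi_*\mathcal O_{\widetilde X}(\lceil K_{\widetilde X}-\pi^*(K_X+\Delta)\rceil+G)$ of $R$ is uniformly $(\Delta,F)$-compatible. 2. The inclusion required in 1 holds whenever $G$ is an effective $\pi$-exceptional integral divisor (every component of $G$ has image of codimension at least two in $X$). 3. In particular, $\pi_*\mathcal O_{\widetilde X}(\lceil K_{\widetilde X}-\pi^*(K_X+\Delta)\rceil)$ is an ideal of $R$ and is uniformly $(\Delta,F)$-compatible; when $\pi$ is a log resolution of $(X,\Delta)$, this is the multiplier ideal of $(X,\Delta)$ computed from $\pi$. 4. Likewise, if $D$ is a reduced integral divisor on $X$ with $D\le\Delta$ and $\pi^{-1}_*D$ is its strict transform, then $\pi_*\mathcal O_{\widetilde X}(\lceil K_{\widetilde X}-\pi^*(K_X+\Delta)\rceil+\pi^{-1}_*D)$ is an ideal of $R$ and is uniformly $(\Delta,F)$-compatible;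 when $\pi$ is a suitable log resolution, this is the adjoint ideal of $(X,\Delta)$ along $D$ computed from $\pi$. -/

import Mathlib

open AlgebraicGeometry CategoryTheory Order
open scoped KaehlerDifferential

universe u

namespace FCompat

/-! ### Normal schemes, prime divisors, Weil divisors -/

/-- An integral scheme is normal if all its local rings are integrally closed domains. -/
class IsNormalScheme (X : Scheme.{u}) [IsIntegral X] : Prop where
  stalk (x : X) : IsIntegrallyClosed (X.presheaf.stalk x)

instance isNormalScheme_Spec (R : Type u) [CommRing R] [IsDomain R] [IsIntegrallyClosed R] :
    IsNormalScheme (Spec (CommRingCat.of R)) where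
  stalk x :=
    let y : PrimeSpectrum R := x
    letI : Algebra R ((Spec (CommRingCat.of R)).presheaf.stalk x) :=
      StructureSheaf.stalkAlgebra R y
    haveI : IsLocalization.AtPrime ((Spec (CommRingCat.of R)).presheaf.stalk x) y.asIdeal :=
      StructureSheaf.IsLocalization.to_stalk R y
    isIntegrallyClosed_of_isLocalization (R := R) ((Spec (CommRingCat.of R)).presheaf.stalk x)
      y.asIdeal.primeCompl y.asIdeal.primeCompl_le_nonZeroDivisors

instance nonempty_top (X : Scheme.{u}) [IsIntegral X] : Nonempty (⊤ : X.Opens) :=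
  ⟨⟨genericPoint X, trivial⟩⟩

/-- On a locally Noetherian normal integral scheme, the local rings at the points of
codimension one are discrete valuation rings. -/
theorem isDiscreteValuationRing_stalk (X : Scheme.{u}) [IsIntegral X] [IsLocallyNoetherian X]
    [IsNormalScheme X] {x : X} (hx : coheight x = 1) :
    IsDiscreteValuationRing (X.presheaf.stalk x) := by
  have h1 := IsNormalScheme.stalk x
  have hd : ringKrullDim (X.presheaf.stalk x) = 1 := by
    rw [ringKrullDim_stalk_eq_coheight, hx]; rfl
  have hf : ¬ IsField (X.presheaf.stalk x) := fun h => by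
    rw [ringKrullDim_eq_zero_of_isField h] at hd; exact zero_ne_one hd
  have hk : Ring.KrullDimLE 1 (X.presheaf.stalk x) := krullDimLE_of_coheight_le hx.le
  have hD : Ring.DimensionLEOne (X.presheaf.stalk x) :=
    ⟨fun hI hI' => Ring.krullDimLE_one_iff_of_noZeroDivisors.mp hk _ hI hI'⟩
  have : IsDedekindDomain (X.presheaf.stalk x) := { }
  exact ((IsDiscreteValuationRing.TFAE (X.presheaf.stalk x) hf).out 0 2).mpr this

/-- A prime divisor of `X`, given by its generic point: a point of codimension one. -/
abbrev PrimeDivisor (X : Scheme.{u}) : Type u := {x : X // coheight x = 1}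

/-- Weil divisors with coefficients in `M` on a Noetherian scheme: finite formal sums of
prime divisors. -/
abbrev WeilDivisor (X : Scheme.{u}) (M : Type) [Zero M] : Type u := PrimeDivisor X →₀ M

section Sections

variable (X : Scheme.{u}) [IsIntegral X] [IsLocallyNoetherian X] [IsNormalScheme X]

/-- The global sections of `𝒪_X(D)`, as a `Γ(X, 𝒪_X)`-submodule of the function field: the
rational functions `f` with `f = 0` or `div f + D ≥ 0`. Here `D` is given by its coefficients. -/
noncomputable def globalSections (D : PrimeDivisor X → ℤ) :
    Submodule Γ(X, ⊤) X.functionField where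
  carrier := {f | f ≠ 0 → ∀ x : PrimeDivisor X, 0 ≤ Scheme.ord f x.1 + D x}
  zero_mem' h := absurd rfl h
  add_mem' {f g} hf hg hfg x := by
    have := isDiscreteValuationRing_stalk X x.2
    by_cases hf0 : f = 0
    · subst hf0; rw [zero_add] at hfg ⊢; exact hg hfg x
    by_cases hg0 : g = 0
    · subst hg0; rw [add_zero] at hfg ⊢; exact hf hfg x
    have h1 := hf hf0 x
    have h2 := hg hg0 x
    have h3 := Scheme.ord_add (x := x.1) hfg
    rcases min_le_iff.mp h3 with h | h <;> omega
  smul_mem' a f hf haf x := by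
    have ha : a ≠ 0 := fun h => haf (by rw [h, zero_smul])
    have hf0 : f ≠ 0 := fun h => haf (by rw [h, smul_zero])
    have h1 := hf hf0 x
    have h2 := Scheme.ord_le_smul (x := x.1) (U := ⊤) trivial ha f
    omega

end Sections

/-! ### Birational morphisms and transport of divisors -/

/-- A morphism is birational if it restricts to an isomorphism between dense open subschemes. -/
class IsBirational {Y X : Scheme.{u}} (π : Y ⟶ X) : Prop where
  birationalOver : Scheme.BirationalOver π (𝟙 X)

instance isDominant_of_isBirational {Y X : Scheme.{u}} (π : Y ⟶ X) [h : IsBirational π] :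
    IsDominant π := by
  obtain ⟨f, hf⟩ := h.birationalOver
  have h1 : IsDominant f.target.ι := Opens.isDominant_ι f.dense_target
  have h2 : f.iso.hom ≫ f.target.ι = f.source.ι ≫ π := by
    simpa [Scheme.PartialIso.IsOver] using hf
  have h3 : IsDominant (f.source.ι ≫ π) := h2 ▸ inferInstance
  exact IsDominant.of_comp f.source.ι π

theorem map_genericPoint {Y X : Scheme.{u}} [IsIntegral Y] [IsIntegral X] (π : Y ⟶ X)
    [IsDominant π] : π (genericPoint Y) = genericPoint X := by
  apply ((genericPoint_spec X).eq _).symm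
  have h := (genericPoint_spec Y).image π.continuous
  rwa [Set.image_univ, π.denseRange.closure_range] at h

/-- The inclusion of function fields `K(X) → K(Y)` induced by a dominant morphism `Y ⟶ X`. -/
noncomputable def functionFieldMap {Y X : Scheme.{u}} [IsIntegral Y] [IsIntegral X] (π : Y ⟶ X)
    [IsDominant π] : X.functionField ⟶ Y.functionField :=
  X.presheaf.stalkSpecializes (specializes_of_eq (map_genericPoint π)) ≫
    π.stalkMap (genericPoint Y)

/-- The pushforward `π_* D` of a divisor under a proper birational morphism `π`: the coefficient
at `x` is the sum of the coefficients of the prime divisors with generic point over `x` (the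
residue field degrees are one, since `π` is birational). -/
noncomputable def pushforwardDivisor {Y X : Scheme.{u}} (π : Y ⟶ X) (D : WeilDivisor Y ℤ)
    (x : PrimeDivisor X) : ℤ :=
  ∑ᶠ y : {y : PrimeDivisor Y // π y.1 = x.1}, D y.1

open Classical in
/-- The strict transform of a divisor under a proper birational morphism. -/
noncomputable def strictTransform {Y X : Scheme.{u}} (π : Y ⟶ X) (D : WeilDivisor X ℤ)
    (y : PrimeDivisor Y) : ℤ :=
  if h : coheight (π y.1) = 1 then D ⟨π y.1, h⟩ else 0

/-- A divisor on `Y` is `π`-exceptional if all its components are mapped into a subset of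
codimension at least two. -/
def IsExceptional {Y X : Scheme.{u}} (π : Y ⟶ X) (G : WeilDivisor Y ℤ) : Prop :=
  ∀ y : PrimeDivisor Y, G y ≠ 0 → 2 ≤ coheight (π y.1)

/-! ### `ℚ`-Cartier divisors and their pullback -/

section Cartier

variable {X : Scheme.{u}} [IsIntegral X] [IsLocallyNoetherian X]

/-- The rational function `f ≠ 0` is an equation of the divisor `m • D` in a neighbourhood
of `x`. -/
def IsLocalEquation (D : PrimeDivisor X → ℚ) (m : ℕ) (x : X) (f : X.functionField) : Prop :=
  f ≠ 0 ∧ ∃ U : X.Opens, x ∈ U ∧ ∀ z : PrimeDivisor X, z.1 ∈ U → (Scheme.ord f z.1 : ℚ) = m * D z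

/-- `D` is `ℚ`-Cartier: some positive multiple of `D` is an integral Cartier divisor. -/
def IsQCartier (D : PrimeDivisor X → ℚ) : Prop :=
  ∃ m : ℕ, 0 < m ∧ ∀ x : X, ∃ f : X.functionField, IsLocalEquation D m x f

open Classical in
/-- The pullback `π^* D = (1/m) π^* (m D)` of a `ℚ`-Cartier divisor `D`: its coefficient at `y`
is `ord_y(π^* f) / m`, where `f` is an equation of the Cartier divisor `m D` near `π y`. This
does not depend on the choice of `m` and `f`. -/
noncomputable def pullbackQCartier {Y : Scheme.{u}} [IsIntegral Y] [IsLocallyNoetherian Y]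
    (π : Y ⟶ X) [IsDominant π] (D : PrimeDivisor X → ℚ) (y : PrimeDivisor Y) : ℚ :=
  if h : ∃ a : ℕ × X.functionField, 0 < a.1 ∧ IsLocalEquation D a.1 (π y.1) a.2 then
    (Scheme.ord ((functionFieldMap π).hom h.choose.2) y.1 : ℚ) / h.choose.1
  else 0

end Cartier

/-! ### Canonical divisors -/

section Forms

variable (k L : Type u) [Field k] [Field L] [Algebra k L]

/-- The top exterior power of the module of Kähler differentials of a field extension. -/
abbrev TopForms : Type u := ⋀[L]^(Module.finrank L Ω[L⁄k]) Ω[L⁄k]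

/-- For a subring `A` of `L`, the `A`-span of the forms `da₁ ∧ ⋯ ∧ daₙ` with `aᵢ ∈ A`, i.e. the
image of `⋀ⁿ Ω_{A/k}` in `⋀ⁿ Ω_{L/k}`. -/
noncomputable def regularForms (A : Type u) [CommRing A] [Algebra A L] :
    AddSubgroup (TopForms k L) :=
  AddSubgroup.closure {η | ∃ (b : A) (a : Fin (Module.finrank L Ω[L⁄k]) → A),
    η = algebraMap A L b • exteriorPower.ιMulti L (Module.finrank L Ω[L⁄k])
      (fun i => KaehlerDifferential.D k L (algebraMap A L (a i)))}

/-- `η` generates the `A`-module of regular top forms. -/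
def IsGenerator (A : Type u) [CommRing A] [Algebra A L] (η : TopForms k L) : Prop :=
  ∀ ω : TopForms k L, ω ∈ regularForms k L A ↔ ∃ b : A, ω = algebraMap A L b • η

end Forms

section Canonical

variable {k : Type u} [Field k] {X : Scheme.{u}} [IsIntegral X]

/-- The `k`-algebra structure on the function field of an integral `k`-scheme. -/
@[reducible] noncomputable def functionFieldAlgebra (s : X ⟶ Spec (CommRingCat.of k)) :
    Algebra k X.functionField :=
  ((X.germToFunctionField ⊤).hom.comp
    (s.appTop.hom.comp (Scheme.ΓSpecIso (CommRingCat.of k)).inv.hom)).toAlgebra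

/-- `K` is a canonical divisor of the normal scheme `X`, essentially of finite type over the
perfect field `k`: it is the divisor of a nonzero rational top differential form `ω`. The order
of `ω` at a prime divisor `x` is the order of `g`, where `ω = g η` and `η` is a generator of the
top differential forms of the discrete valuation ring `𝒪_{X,x}`. -/
def IsCanonicalDivisor [IsLocallyNoetherian X] (s : X ⟶ Spec (CommRingCat.of k))
    (K : WeilDivisor X ℤ) : Prop :=
  letI := functionFieldAlgebra s
  ∃ ω : TopForms k X.functionField, ω ≠ 0 ∧ ∀ x : PrimeDivisor X,
    ∃ (η : TopForms k X.functionField) (g : X.functionField),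
      IsGenerator k X.functionField (X.presheaf.stalk x.1) η ∧ g ≠ 0 ∧ ω = g • η ∧
        Scheme.ord g x.1 = K x

end Canonical

/-! ### Ideals of a normal domain -/

section Affine

variable {R : Type u} [CommRing R]

/-- The inclusion of `R` in the function field of an integral scheme `Y` over `Spec R`, through
`Γ(Y, 𝒪_Y)`. -/
noncomputable def toGlobal {Y : Scheme.{u}} (π : Y ⟶ Spec (CommRingCat.of R)) :
    R →+* Γ(Y, ⊤) :=
  π.appTop.hom.comp (Scheme.ΓSpecIso (CommRingCat.of R)).inv.hom

section Pushforward

variable {Y : Scheme.{u}} [IsIntegral Y] [IsLocallyNoetherian Y] [IsNormalScheme Y]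
  (π : Y ⟶ Spec (CommRingCat.of R))

/-- `π_* 𝒪_Y(D)` is contained in `𝒪_X`, where `X = Spec R` (both inside the function field):
every global section of `𝒪_Y(D)` is an element of `R`. -/
def PushforwardIsIdeal (D : PrimeDivisor Y → ℤ) : Prop :=
  ∀ f ∈ globalSections Y D, ∃ r : R, f = algebraMap Γ(Y, ⊤) Y.functionField (toGlobal π r)

/-- The ideal `π_* 𝒪_Y(D) ∩ R` of `R`; this is `π_* 𝒪_Y(D)` if the latter is contained in
`R`. -/
noncomputable def pushforwardIdeal (D : PrimeDivisor Y → ℤ) : Ideal R :=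
  Ideal.comap (toGlobal π)
    ((globalSections Y D).comap (Algebra.linearMap Γ(Y, ⊤) Y.functionField))

end Pushforward

variable [IsDomain R] [IsNoetherianRing R] [IsIntegrallyClosed R]

/-- Uniformly `(Δ, F)`-compatible ideals of a normal domain `R` of characteristic `p`: for all
`e > 0`, every `R`-linear map `φ : F^e_* R(⌈(p^e - 1)Δ⌉) → R` sends `F^e_* I` into `I`. Such a
map is an additive map with `φ (r ^ (p ^ e) x) = r φ(x)`. -/
def IsUniformlyFCompatible (p : ℕ) (Δ : WeilDivisor (Spec (CommRingCat.of R)) ℚ) (I : Ideal R) :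
    Prop :=
  ∀ e : ℕ, 0 < e →
    ∀ φ : globalSections (Spec (CommRingCat.of R)) (fun x => ⌈((p : ℚ) ^ e - 1) * Δ x⌉) →+ R,
      (∀ (r : R) (m : globalSections (Spec (CommRingCat.of R))
          (fun x => ⌈((p : ℚ) ^ e - 1) * Δ x⌉)),
        φ (toGlobal (𝟙 (Spec (CommRingCat.of R))) (r ^ p ^ e) • m) = r * φ m) →
      ∀ a ∈ I, ∀ m : globalSections (Spec (CommRingCat.of R))
          (fun x => ⌈((p : ℚ) ^ e - 1) * Δ x⌉),
        (m : (Spec (CommRingCat.of R)).functionField) =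
          algebraMap Γ(Spec (CommRingCat.of R), ⊤) (Spec (CommRingCat.of R)).functionField
            (toGlobal (𝟙 (Spec (CommRingCat.of R))) a) →
        φ m ∈ I

end Affine

/-- The coefficients of the integral divisor `⌈K_Y - π^*(K_X + Δ)⌉` on `Y`. -/
noncomputable def roundedDiscrepancy {Y X : Scheme.{u}} [IsIntegral Y] [IsLocallyNoetherian Y]
    [IsIntegral X] [IsLocallyNoetherian X] (π : Y ⟶ X) [IsDominant π]
    (KY : WeilDivisor Y ℤ) (KX : WeilDivisor X ℤ) (Δ : WeilDivisor X ℚ)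
    (y : PrimeDivisor Y) : ℤ :=
  ⌈(KY y : ℚ) - pullbackQCartier π (fun x => (KX x : ℚ) + Δ x) y⌉

end FCompat

/-!
# Multiplier-type ideals are uniformly `(Δ, F)`-compatible

Everything takes place inside the function field `L` of `Y`, which is also that of `X = Spec R`.
Fix `e > 0`, put `q = p ^ e`, and let `φ : R(⌈(q - 1)Δ⌉) → R` be a `q⁻¹`-linear map. Clearing
denominators extends it to a `q⁻¹`-linear map `Φ : L → L` (`exists_extension`). Let `ω` be the
rational top form with divisor `K_Y`. Over a perfect field there is a Cartier operator `C` on top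
forms of `L` (`exists_isCartierOperator`), and all `q⁻¹`-linear maps on `L` come from it: there is
an `h ∈ L` with `Φ(f) ω = Cᵉ(f h ω)` for all `f` (`IsCartierOperator.exists_iterate_smul_eq`).

The map `φ` is thereby replaced by a divisor. Let `η` generate the regular top forms of a normal
local ring `A` of `L`. Then `Cᵉ` maps `A η` to `A η`, and `f ∈ A` as soon as `Cᵉ(A f η) ⊆ A η`
(`IsCartierOperator.exists_iterate_smul_eq_algebraMap_smul`,
`IsCartierOperator.mem_range_of_forall_iterate`).

* At a prime divisor `x` of `X`, the map `Φ` sends the stalk of `𝒪_X(⌈(q - 1)Δ⌉)` into `𝒪_{X,x}`,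
  because `Δ` is effective and hence sections at `x` become global after multiplication by a
  unit at `x` (`exists_mul_mem_globalSections`). The second property of `Cᵉ` turns this into
  `div_X h ≥ (q - 1)(K_X + Δ)` (`IsCartierOperator.mul_add_le_ord`). Here one uses that there is
  exactly one point `y` of codimension one over `x`, and `𝒪_{Y,y} = 𝒪_{X,x}`, by the valuative
  criterion (`exists_coheight_eq_one`, `pushforwardDivisor_apply`).
* Hence `div_Y h ≥ (q - 1) π^*(K_X + Δ)`: locally on `X`, the function `h ^ m / f ^ (q - 1)`, where
  `f` is an equation of `m (K_X + Δ)`, has no poles in codimension one, so it is regular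
  (`mul_pullbackQCartier_le_ord`).
* At a prime divisor `y` of `Y`, put `b = ⌈K_Y - π^*(K_X + Δ)⌉ + G` with `G ≥ 0`. If
  `div v ≥ -b` at `y`, then `v h ω` has order at least
  `-b + (q - 1)(K_Y - b) + K_Y = q (K_Y - b)`, since `b ≥ K_Y - π^*(K_X + Δ)`, and the first
  property of `Cᵉ` gives `div Φ(v) ≥ -b` (`IsCartierOperator.le_ord_apply`).

So `Φ` preserves the sections of `𝒪_Y(⌈K_Y - π^*(K_X + Δ)⌉ + G)`, which is the compatibility
(`isUniformlyFCompatible_pushforwardIdeal`). For the inclusions in `𝒪_X`, at the prime divisor of `Y`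
over a prime divisor `x` of `X` the coefficient of `⌈K_Y - π^*(K_X + Δ)⌉` is `⌈-Δ⌉`
(`roundedDiscrepancy_eq`). The coefficient of the whole divisor there is then at most zero, both for
`G` exceptional and for `G` the strict transform of an integral `D ≤ Δ`, and a rational function
without poles in codimension one on the normal scheme `X` is in `R`
(`pushforwardIsIdeal_of_nonpos`).
-/

namespace FCompat

/-! ### Normal Noetherian domains and their localizations at height one primes -/

/-- Algebraic Hartogs: if `f` is not in `A`, then a maximal element `P = (A : u)` among the
denominator ideals of multiples `u ∉ A` of `f` is a prime of height one, as `P u ⊄ P` by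
normality, and `f` is not in `A_P`. -/
theorem mem_range_of_forall_height_one {A K : Type*} [CommRing A] [IsDomain A]
    [IsNoetherianRing A] [IsIntegrallyClosed A] [Field K] [Algebra A K] [IsFractionRing A K]
    (f : K) (hf : ∀ P : Ideal A, P.IsPrime → P.height = 1 →
      ∃ s ∉ P, ∃ a, algebraMap A K s * f = algebraMap A K a) :
    f ∈ (algebraMap A K).range := by
  by_contra hfA
  let den : K → Ideal A := fun u => ((1 : Submodule A K).comap (LinearMap.toSpanSingleton A K u))
  have hden : ∀ u a, a ∈ den u ↔ ∃ b, algebraMap A K b = algebraMap A K a * u := by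
    intro u a
    simp [den, Submodule.mem_one, Algebra.smul_def]
  let F : Set (Ideal A) := {I | ∃ c : A, algebraMap A K c * f ∉ (algebraMap A K).range ∧
    I = den (algebraMap A K c * f)}
  obtain ⟨P, ⟨c, hc, rfl⟩, hmax⟩ := set_has_maximal_iff_noetherian.mpr ‹_› F
    ⟨den (algebraMap A K 1 * f), 1, by simpa using hfA, rfl⟩
  set u := algebraMap A K c * f with hu
  have hprime : (den u).IsPrime := by
    refine ⟨?_, ?_⟩
    · rw [Ideal.ne_top_iff_one, hden]
      rintro ⟨b, hb⟩
      exact hc ⟨b, by simpa using hb⟩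
    · intro x y hxy
      by_contra! h
      have hx' : algebraMap A K (x * c) * f ∉ (algebraMap A K).range := by
        rintro ⟨b, hb⟩
        exact h.1 ((hden _ _).mpr ⟨b, by rw [hb, hu, map_mul, mul_assoc]⟩)
      refine hmax _ ⟨x * c, hx', rfl⟩ (lt_of_le_of_ne ?_ ?_)
      · intro z hz
        obtain ⟨b, hb⟩ := (hden _ _).mp hz
        exact (hden _ _).mpr ⟨x * b, by rw [map_mul, hb, hu, map_mul]; ring⟩
      · intro he
        apply h.2
        rw [he]
        obtain ⟨b, hb⟩ := (hden _ _).mp hxy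
        exact (hden _ _).mpr ⟨b, by rw [hb, hu]; simp only [map_mul]; ring⟩
  have hinj := IsFractionRing.injective A K
  have hne : den u ≠ ⊥ := by
    obtain ⟨a, b, hb, hab⟩ := IsFractionRing.div_surjective (A := A) u
    have hb0 : b ≠ 0 := nonZeroDivisors.ne_zero hb
    refine (Submodule.ne_bot_iff _).mpr ⟨b, (hden _ _).mpr ⟨a, ?_⟩, hb0⟩
    rw [← hab]
    have : algebraMap A K b ≠ 0 := by simpa [map_ne_zero_iff _ hinj] using hb0
    field_simp
  -- some `x ∈ P` has `x u ∉ P`: otherwise `u` would be integral over `A`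
  obtain ⟨x, hx, s, hs, hxs⟩ :
      ∃ x ∈ den u, ∃ s ∉ den u, algebraMap A K s = algebraMap A K x * u := by
    by_contra! h
    apply hc
    have hint : IsIntegral A u := by
      refine isIntegral_of_smul_mem_submodule
        (Submodule.map (Algebra.linearMap A K) (den u)) ?_ ?_ u ?_
      · obtain ⟨z, hz, hz0⟩ := (Submodule.ne_bot_iff _).mp hne
        refine (Submodule.ne_bot_iff _).mpr ⟨_, ⟨z, hz, rfl⟩, ?_⟩
        simpa [map_ne_zero_iff _ hinj] using hz0
      · exact Submodule.FG.map _ (IsNoetherian.noetherian _)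
      · rintro _ ⟨z, hz, rfl⟩
        obtain ⟨b, hb⟩ := (hden _ _).mp hz
        refine ⟨b, by_contra fun hbn => h z hz b hbn hb, ?_⟩
        simp only [Algebra.linearMap_apply, smul_eq_mul]
        rw [hb, mul_comm]
    exact IsIntegrallyClosed.isIntegral_iff.mp hint
  have hmin : den u ∈ (Ideal.span {x}).minimalPrimes := by
    refine ⟨⟨hprime, by rwa [Ideal.span_le, Set.singleton_subset_iff]⟩, ?_⟩
    rintro Q ⟨hQ, hxQ⟩ hQP y hy
    obtain ⟨b, hb⟩ := (hden _ _).mp hy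
    have : y * s = b * x := by
      apply hinj
      rw [map_mul, map_mul, hxs, hb]; ring
    have hmem : y * s ∈ Q := this ▸ Q.mul_mem_left b (hxQ (Ideal.mem_span_singleton_self x))
    exact (hQ.mem_or_mem hmem).resolve_right fun h => hs (hQP h)
  have hle : (den u).height ≤ 1 :=
    Ideal.height_le_one_of_isPrincipal_of_mem_minimalPrimes (Ideal.span {x}) _ hmin
  have hh : (den u).height = 1 := by
    refine le_antisymm hle ?_
    rw [Order.one_le_iff_ne_zero, Ne, Ideal.height_eq_zero_iff_eq_bot]
    exact hne
  obtain ⟨t, ht, a, hta⟩ := hf _ hprime hh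
  refine ht ((hden _ _).mpr ⟨c * a, ?_⟩)
  rw [map_mul, ← hta, hu]; ring

/-! ### Differential bases and `p`-bases -/

section PBasis

theorem exists_basis_kaehlerDifferential (k L : Type*) [Field k] [Field L] [Algebra k L]
    [Algebra.EssFiniteType k L] :
    ∃ (B : Module.Basis (Fin (Module.finrank L Ω[L⁄k])) L Ω[L⁄k])
      (a : Fin (Module.finrank L Ω[L⁄k]) → L), ∀ i, B i = KaehlerDifferential.D k L (a i) := by
  obtain ⟨s, hs, hspan, hli⟩ := exists_linearIndependent L (Set.range (KaehlerDifferential.D k L))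
  rw [KaehlerDifferential.span_range_derivation] at hspan
  let B : Module.Basis s L Ω[L⁄k] := Module.Basis.mk hli (by simp [hspan])
  have : Finite s := Module.Finite.finite_basis B
  let e : s ≃ Fin (Module.finrank L Ω[L⁄k]) :=
    (Finite.equivFin s).trans (finCongr (Module.finrank_eq_nat_card_basis B).symm)
  choose a ha using fun x : s => hs x.2
  refine ⟨B.reindex e, fun i => a (e.symm i), fun i => ?_⟩
  rw [ha]
  simp [B]

variable {k L : Type*} [Field k] [Field L] [Algebra k L] {n : ℕ}
  (B : Module.Basis (Fin n) L Ω[L⁄k]) (a : Fin n → L)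

/-- The derivation `∂/∂aᵢ` of `L` for a basis `(daᵢ)` of the differentials. -/
noncomputable def partialDeriv (i : Fin n) : Derivation k L L :=
  (B.coord i).compDer (KaehlerDifferential.D k L)

theorem partialDeriv_apply (i : Fin n) (x : L) :
    partialDeriv B i x = B.repr (KaehlerDifferential.D k L x) i := rfl

variable {B a}

theorem partialDeriv_self (ha : ∀ i, B i = KaehlerDifferential.D k L (a i)) (i j : Fin n) :
    partialDeriv B i (a j) = if i = j then 1 else 0 := by
  rw [partialDeriv_apply, ← ha, B.repr_self, Finsupp.single_apply]
  simp only [eq_comm]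

theorem ne_zero_of_basis (ha : ∀ i, B i = KaehlerDifferential.D k L (a i)) (i : Fin n) :
    a i ≠ 0 := fun h => B.ne_zero i (by rw [ha, h, map_zero])

theorem derivation_pow_char {p : ℕ} [CharP L p] (D : Derivation k L L) (c : L) :
    D (c ^ p) = 0 := by
  rw [D.leibniz_pow, ← Nat.cast_smul_eq_nsmul L, CharP.cast_eq_zero L p, zero_smul]

theorem derivation_pow_char_mul {p : ℕ} [CharP L p] (D : Derivation k L L) (c x : L) :
    D (c ^ p * x) = c ^ p * D x := by
  rw [D.leibniz, derivation_pow_char, smul_zero, add_zero, smul_eq_mul]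

theorem derivation_prod_eq_zero (D : Derivation k L L) {ι : Type*} (s : Finset ι) (f : ι → L)
    (m : ι → ℕ) (h : ∀ i ∈ s, D (f i) = 0) : D (∏ i ∈ s, f i ^ m i) = 0 := by
  refine Finset.prod_induction _ (fun x => D x = 0) ?_ ?_ ?_
  · intro x y hx hy
    rw [D.leibniz, hx, hy, smul_zero, smul_zero, add_zero]
  · exact D.map_one_eq_zero
  · intro i hi
    rw [D.leibniz_pow, h i hi, smul_zero, smul_zero]

theorem partialDeriv_prod (ha : ∀ i, B i = KaehlerDifferential.D k L (a i)) (i : Fin n)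
    (I : Fin n → ℕ) :
    partialDeriv B i (∏ j, a j ^ I j) = (∏ j, a j ^ I j) * (I i * (a i)⁻¹) := by
  classical
  have h0 : partialDeriv B i (∏ j ∈ Finset.univ.erase i, a j ^ I j) = 0 := by
    refine derivation_prod_eq_zero _ _ _ _ fun j hj => ?_
    rw [partialDeriv_self ha, if_neg (Finset.ne_of_mem_erase hj).symm]
  have hi := ne_zero_of_basis ha i
  rw [← Finset.mul_prod_erase _ _ (Finset.mem_univ i), Derivation.leibniz, h0,
    Derivation.leibniz_pow, partialDeriv_self ha, if_pos rfl]
  rcases Nat.eq_zero_or_pos (I i) with h | h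
  · simp [h]
  · obtain ⟨m, hm⟩ := Nat.exists_eq_succ_of_ne_zero h.ne'
    rw [hm]
    simp only [nsmul_eq_mul, smul_eq_mul, Nat.succ_sub_one, pow_succ]
    field_simp
    ring

variable (p : ℕ) [Fact p.Prime]

/-- The set of monomials `c ^ p * a ^ I` with exponents smaller than `p`. -/
def monomials (a : Fin n → L) : Set L :=
  {x | ∃ (c : L) (I : Fin n → ℕ), (∀ i, I i < p) ∧ x = c ^ p * ∏ i, a i ^ I i}

theorem mem_monomials (a : Fin n → L) (c : L) (I : Fin n → ℕ) :
    c ^ p * ∏ i, a i ^ I i ∈ monomials p a := by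
  refine ⟨c * ∏ i, a i ^ (I i / p), fun i => I i % p,
    fun i => Nat.mod_lt _ (Fact.out : p.Prime).pos, ?_⟩
  rw [mul_pow, mul_assoc, ← Finset.prod_pow, ← Finset.prod_mul_distrib]
  congr 2
  ext i
  rw [← pow_mul, ← pow_add, Nat.div_add_mod']

variable [CharP L p]

/-- A differential basis of a finitely generated extension of a perfect field is a `p`-basis:
`L` is unramified, hence separable, over the subfield generated by `L ^ p` and the `aᵢ`, and it
is purely inseparable. -/
theorem closure_monomials [PerfectField k] [Algebra.EssFiniteType k L]
    (ha : ∀ i, B i = KaehlerDifferential.D k L (a i)) :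
    AddSubmonoid.closure (monomials p a) = ⊤ := by
  have hp : p.Prime := Fact.out
  have : CharP k p := (RingHom.charP_iff (algebraMap k L) (algebraMap k L).injective p).mpr ‹_›
  let E := IntermediateField.adjoin k (Set.range (fun x : L => x ^ p) ∪ Set.range a)
  have hpE : ∀ x : L, x ^ p ∈ E := fun x =>
    IntermediateField.subset_adjoin _ _ (Or.inl ⟨x, rfl⟩)
  have haE : ∀ i, a i ∈ E := fun i => IntermediateField.subset_adjoin _ _ (Or.inr ⟨i, rfl⟩)
  have : CharP E p := (RingHom.charP_iff (algebraMap E L) (algebraMap E L).injective p).mpr ‹_›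
  have : ExpChar E p := ExpChar.prime hp
  have : Algebra.EssFiniteType E L := Algebra.EssFiniteType.of_comp k E L
  have hmap : ∀ x, KaehlerDifferential.map k E L L x = 0 := by
    intro x
    have : KaehlerDifferential.map k E L L = 0 := by
      refine B.ext fun i => ?_
      rw [ha, KaehlerDifferential.map_D]
      exact (KaehlerDifferential.D E L).map_algebraMap (⟨a i, haE i⟩ : E)
    rw [this]; rfl
  have hsub : Subsingleton Ω[L⁄E] := by
    refine ⟨fun x y => ?_⟩
    obtain ⟨x, rfl⟩ := KaehlerDifferential.map_surjective k E L x
    obtain ⟨y, rfl⟩ := KaehlerDifferential.map_surjective k E L y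
    rw [hmap, hmap]
  have : Algebra.FormallyUnramified E L := ⟨hsub⟩
  have : Algebra.IsSeparable E L := Algebra.FormallyUnramified.isSeparable E L
  have : IsPurelyInseparable E L := (isPurelyInseparable_iff_pow_mem E p).mpr fun x =>
    ⟨1, ⟨x ^ p, hpE x⟩, by rw [pow_one]; rfl⟩
  have htop : ∀ x : L, x ∈ E := fun x => by
    obtain ⟨y, rfl⟩ := IsPurelyInseparable.surjective_algebraMap_of_isSeparable E L x
    exact y.2
  rw [eq_top_iff]
  intro x _
  have hmul : ∀ x ∈ AddSubmonoid.closure (monomials p a),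
      ∀ y ∈ AddSubmonoid.closure (monomials p a),
        x * y ∈ AddSubmonoid.closure (monomials p a) := by
    intro x hx y hy
    induction hx using AddSubmonoid.closure_induction with
    | zero => rw [zero_mul]; exact zero_mem _
    | add x x' _ _ h h' => rw [add_mul]; exact add_mem h h'
    | mem x hx =>
      obtain ⟨c, I, -, rfl⟩ := hx
      induction hy using AddSubmonoid.closure_induction with
      | zero => rw [mul_zero]; exact zero_mem _
      | add x x' _ _ h h' => rw [mul_add]; exact add_mem h h'
      | mem y hy =>
        obtain ⟨d, J, -, rfl⟩ := hy
        apply AddSubmonoid.subset_closure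
        convert mem_monomials p a (c * d) (I + J) using 1
        simp only [Pi.add_apply, pow_add, Finset.prod_mul_distrib]
        ring
  have hpow : ∀ c : L, c ^ p ∈ AddSubmonoid.closure (monomials p a) := fun c =>
    AddSubmonoid.subset_closure (by simpa using mem_monomials p a c 0)
  have hpow' : ∀ x ∈ AddSubmonoid.closure (monomials p a), ∀ m : ℕ,
      x ^ m ∈ AddSubmonoid.closure (monomials p a) := by
    intro x hx m
    induction m with
    | zero => simpa using hpow 1
    | succ m ih => rw [pow_succ]; exact hmul _ ih _ hx
  refine IntermediateField.adjoin_induction k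
    (p := fun x _ => x ∈ AddSubmonoid.closure (monomials p a)) ?_ ?_ ?_ ?_ ?_ (htop x)
  · rintro _ (⟨x, rfl⟩ | ⟨i, rfl⟩)
    · exact hpow x
    · refine AddSubmonoid.subset_closure ?_
      classical
      convert mem_monomials p a 1 (Pi.single i 1) using 1
      rw [one_pow, one_mul, Finset.prod_eq_single i]
      · simp
      · intro j _ hj; simp [hj]
      · simp
  · intro c
    have : ExpChar k p := ExpChar.prime hp
    obtain ⟨d, rfl⟩ := surjective_frobenius k p c
    rw [frobenius_def, map_pow]
    exact hpow _
  · intro x y _ _ hx hy; exact add_mem hx hy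
  · intro x _ hx
    by_cases h0 : x = 0
    · rw [h0, inv_zero]; exact zero_mem _
    have : x⁻¹ = x ^ (p - 1) * x⁻¹ ^ p := by
      rw [inv_pow, ← div_eq_mul_inv, eq_div_iff (pow_ne_zero _ h0)]
      conv_lhs => rw [← Nat.sub_add_cancel hp.one_le, pow_succ]
      field_simp
    rw [this]
    exact hmul _ (hpow' _ hx _) _ (hpow _)
  · intro x y _ _ hx hy; exact hmul _ hx _ hy

/-- Expansion in monomials of a `p`-basis. -/
theorem exists_eq_sum_monomials (h : AddSubmonoid.closure (monomials p a) = ⊤) (f : L) :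
    ∃ c : (Fin n → Fin p) → L, f = ∑ I, c I ^ p * ∏ i, a i ^ (I i : ℕ) := by
  classical
  have hp : p.Prime := Fact.out
  have : ExpChar L p := ExpChar.prime hp
  have hf : f ∈ AddSubmonoid.closure (monomials p a) := h ▸ AddSubmonoid.mem_top f
  induction hf using AddSubmonoid.closure_induction with
  | zero => exact ⟨0, by simp [hp.ne_zero]⟩
  | add x y _ _ hx hy =>
    obtain ⟨c, rfl⟩ := hx
    obtain ⟨d, rfl⟩ := hy
    refine ⟨c + d, ?_⟩
    simp only [Pi.add_apply, add_pow_expChar, add_mul, Finset.sum_add_distrib]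
  | mem x hx =>
    obtain ⟨c, I, hI, rfl⟩ := hx
    refine ⟨Pi.single (fun i => ⟨I i, hI i⟩) c, ?_⟩
    rw [Finset.sum_eq_single (fun i => ⟨I i, hI i⟩)]
    · simp
    · intro J _ hJ
      simp [hJ, hp.ne_zero]
    · simp

end PBasis

/-! ### The Cartier operator in coordinates -/

section Coordinates

variable {k L : Type*} [Field k] [Field L] [Algebra k L] {n : ℕ}
  {B : Module.Basis (Fin n) L Ω[L⁄k]} {a : Fin n → L} (p : ℕ)

variable (B) in
/-- The differential operator `∏ᵢ -(∂/∂aᵢ) ^ (p - 1)`, applied for the indices `i` in a list. -/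
noncomputable def topOp (l : List (Fin n)) (f : L) : L :=
  l.foldr (fun i f => -(partialDeriv B i)^[p - 1] f) f

theorem iterate_derivation_add (D : Derivation k L L) (m : ℕ) (x y : L) :
    D^[m] (x + y) = D^[m] x + D^[m] y := by
  induction m with
  | zero => rfl
  | succ m ih => rw [Function.iterate_succ_apply', ih, map_add, ← Function.iterate_succ_apply' D,
      ← Function.iterate_succ_apply' D]

theorem iterate_derivation_pow_char_mul [CharP L p] (D : Derivation k L L) (m : ℕ) (c x : L) :
    D^[m] (c ^ p * x) = c ^ p * D^[m] x := by
  induction m with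
  | zero => rfl
  | succ m ih => rw [Function.iterate_succ_apply', ih, derivation_pow_char_mul,
      ← Function.iterate_succ_apply' D]

theorem topOp_add (l : List (Fin n)) (x y : L) :
    topOp B p l (x + y) = topOp B p l x + topOp B p l y := by
  induction l with
  | nil => rfl
  | cons i l ih =>
    change -(partialDeriv B i)^[p - 1] (topOp B p l (x + y)) = _
    rw [ih, iterate_derivation_add, neg_add]
    rfl

theorem topOp_pow_char_mul [CharP L p] (l : List (Fin n)) (c x : L) :
    topOp B p l (c ^ p * x) = c ^ p * topOp B p l x := by
  induction l with
  | nil => rfl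
  | cons i l ih =>
    change -(partialDeriv B i)^[p - 1] (topOp B p l (c ^ p * x)) = _
    rw [ih, iterate_derivation_pow_char_mul, ← mul_neg]
    rfl

theorem topOp_mem (A : AddSubgroup L) (hA : ∀ i, ∀ x ∈ A, partialDeriv B i x ∈ A)
    (l : List (Fin n)) {x : L} (hx : x ∈ A) : topOp B p l x ∈ A := by
  induction l with
  | nil => exact hx
  | cons i l ih =>
    have h : ∀ m, (partialDeriv B i)^[m] (topOp B p l x) ∈ A := fun m => by
      induction m with
      | zero => exact ih
      | succ m ih' =>
        rw [Function.iterate_succ_apply']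
        exact hA i _ ih'
    exact neg_mem (h _)

theorem iterate_partialDeriv_prod (ha : ∀ i, B i = KaehlerDifferential.D k L (a i)) (i : Fin n)
    (m : ℕ) (I : Fin n → ℕ) (hm : m ≤ I i) :
    (partialDeriv B i)^[m] (∏ j, a j ^ I j) =
      (I i).descFactorial m * ∏ j, a j ^ (Function.update I i (I i - m) j) := by
  induction m with
  | zero => simp
  | succ m ih =>
    have hi := ne_zero_of_basis ha i
    rw [Function.iterate_succ_apply', ih (by omega), ← nsmul_eq_mul, map_nsmul,
      partialDeriv_prod ha, Nat.descFactorial_succ, nsmul_eq_mul, Function.update_self]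
    rw [← Finset.mul_prod_erase _ _ (Finset.mem_univ i),
      ← Finset.mul_prod_erase _ _ (Finset.mem_univ i), Function.update_self, Function.update_self]
    have h1 : ∀ r, ∏ x ∈ Finset.univ.erase i, a x ^ (Function.update I i r x) =
        ∏ x ∈ Finset.univ.erase i, a x ^ I x := fun r =>
      Finset.prod_congr rfl fun j hj => by rw [Function.update_of_ne (Finset.ne_of_mem_erase hj)]
    rw [h1, h1, show I i - m = I i - (m + 1) + 1 by omega, pow_succ]
    push_cast
    field_simp

variable [Fact p.Prime] [CharP L p]

theorem neg_iterate_partialDeriv_monomial (ha : ∀ i, B i = KaehlerDifferential.D k L (a i))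
    (i : Fin n) (I : Fin n → ℕ) (hI : I i < p) :
    -(partialDeriv B i)^[p - 1] (∏ j, a j ^ I j) =
      if I i = p - 1 then ∏ j, a j ^ (Function.update I i 0 j) else 0 := by
  have hp : p.Prime := Fact.out
  split_ifs with h
  · rw [iterate_partialDeriv_prod ha _ _ _ h.ge, h, Nat.descFactorial_self, Nat.sub_self]
    have hw : (((p - 1).factorial : ℕ) : L) = -1 := by
      have := congrArg (ZMod.castHom (dvd_refl p) L) (ZMod.wilsons_lemma p)
      rwa [map_natCast, map_neg, map_one] at this
    rw [hw]; ring
  · have hlt : I i < p - 1 := by omega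
    obtain ⟨r, hr⟩ : ∃ r, p - 1 = r + 1 + I i := ⟨p - 1 - I i - 1, by omega⟩
    have h0 : (partialDeriv B i)^[I i + 1] (∏ j, a j ^ I j) = 0 := by
      rw [Function.iterate_succ_apply', iterate_partialDeriv_prod ha _ _ _ le_rfl,
        ← nsmul_eq_mul, map_nsmul, partialDeriv_prod ha]
      simp
    rw [hr, add_assoc, add_comm 1, Function.iterate_add_apply, h0,
      Function.iterate_fixed (map_zero _), neg_zero]

open Classical in
theorem topOp_monomial (ha : ∀ i, B i = KaehlerDifferential.D k L (a i)) (l : List (Fin n))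
    (hl : l.Nodup) (I : Fin n → ℕ) (hI : ∀ i, I i < p) :
    topOp B p l (∏ j, a j ^ I j) = if ∀ i ∈ l, I i = p - 1 then
      ∏ j, a j ^ (if j ∈ l then 0 else I j) else 0 := by
  induction l with
  | nil => simp [topOp]
  | cons i l ih =>
    obtain ⟨hil, hl⟩ := List.nodup_cons.mp hl
    change -(partialDeriv B i)^[p - 1] (topOp B p l _) = _
    rw [ih hl]
    by_cases h : ∀ i ∈ l, I i = p - 1
    · rw [if_pos h, neg_iterate_partialDeriv_monomial p ha _ _ (by rw [if_neg hil]; exact hI i),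
        if_neg hil]
      by_cases hi : I i = p - 1
      · rw [if_pos hi, if_pos (by simpa [hi] using h)]
        refine Finset.prod_congr rfl fun j _ => ?_
        congr 1
        by_cases hj : j = i
        · subst hj; simp
        · simp [hj]
      · rw [if_neg hi, if_neg (by simp [hi])]
    · rw [if_neg h, if_neg (fun h' => h fun j hj => h' j (List.mem_cons_of_mem _ hj)),
        Function.iterate_fixed (map_zero _), neg_zero]

/-- The Cartier operator in coordinates: it maps `∑ c_I ^ p * a ^ I` to `c_(p-1,…,p-1)`. It
preserves normal subrings that are stable under the `∂/∂aᵢ`, because `(C f) ^ p` is obtained from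
`f` by the operator `∏ᵢ -(∂/∂aᵢ) ^ (p - 1)`. -/
theorem exists_cartier_coordinates [PerfectField k] [Algebra.EssFiniteType k L]
    (ha : ∀ i, B i = KaehlerDifferential.D k L (a i)) :
    ∃ C : L →+ L, (∀ f g, C (f ^ p * g) = f * C g) ∧
      (C (∏ i, a i ^ (p - 1)) = 1) ∧
      (∀ I : Fin n → ℕ, (∀ i, I i < p) → (∃ i, I i ≠ p - 1) → C (∏ i, a i ^ I i) = 0) ∧
      (∀ A : AddSubgroup L, (∀ i, ∀ x ∈ A, partialDeriv B i x ∈ A) → ∀ f ∈ A, C f ^ p ∈ A) := by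
  classical
  have hp : p.Prime := Fact.out
  have : ExpChar L p := ExpChar.prime hp
  have hmon : ∀ I : Fin n → ℕ, (∀ i, I i < p) → topOp B p (List.finRange n) (∏ j, a j ^ I j) =
      if ∀ i, I i = p - 1 then 1 else 0 := by
    intro I hI
    rw [topOp_monomial p ha _ (List.nodup_finRange n) I hI]
    simp
  have hroot : ∀ f : L, ∃ g, g ^ p = topOp B p (List.finRange n) f := by
    intro f
    have hf : f ∈ AddSubmonoid.closure (monomials p a) :=
      closure_monomials p ha ▸ AddSubmonoid.mem_top f
    induction hf using AddSubmonoid.closure_induction with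
    | zero =>
      refine ⟨0, ?_⟩
      have := topOp_add (B := B) p (List.finRange n) 0 0
      rw [add_zero, left_eq_add] at this
      rw [this, zero_pow hp.ne_zero]
    | add x y _ _ hx hy =>
      obtain ⟨c, hc⟩ := hx
      obtain ⟨d, hd⟩ := hy
      exact ⟨c + d, by rw [add_pow_expChar, hc, hd, topOp_add]⟩
    | mem x hx =>
      obtain ⟨c, I, hI, rfl⟩ := hx
      rw [topOp_pow_char_mul, hmon I hI]
      split_ifs
      · exact ⟨c, by rw [mul_one]⟩
      · exact ⟨0, by rw [mul_zero, zero_pow hp.ne_zero]⟩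
  choose C hC using hroot
  have hinj : ∀ x y : L, x ^ p = y ^ p → x = y := fun x y h => frobenius_inj L p h
  refine ⟨AddMonoidHom.mk' C fun x y => hinj _ _ ?_, fun f g => hinj _ _ ?_, hinj _ _ ?_,
    fun I hI hi => hinj _ _ ?_, fun A hA f hf => ?_⟩
  · rw [hC, add_pow_expChar, hC, hC, topOp_add]
  · simp only [AddMonoidHom.mk'_apply]
    rw [hC, mul_pow, hC, topOp_pow_char_mul]
  · simp only [AddMonoidHom.mk'_apply]
    rw [hC, hmon _ (fun _ => Nat.sub_lt hp.pos one_pos), if_pos (fun _ => rfl), one_pow]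
  · simp only [AddMonoidHom.mk'_apply]
    rw [hC, hmon I hI, if_neg (by push Not; exact hi), zero_pow hp.ne_zero]
  · simp only [AddMonoidHom.mk'_apply]
    rw [hC]
    exact topOp_mem p A hA _ hf

end Coordinates

/-! ### Independence of the Cartier operator of the coordinates -/

section Independence

variable {k L : Type*} [Field k] [Field L] [Algebra k L] {n : ℕ}
  (B : Module.Basis (Fin n) L Ω[L⁄k]) {a : Fin n → L}

/-- The coefficient of `db₁ ∧ ⋯ ∧ dbₙ` in the basis of top forms given by `B`. -/
noncomputable def jacobian (b : Fin n → L) : L := B.det fun j => KaehlerDifferential.D k L (b j)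

/-- `x ↦ jacobian (b₁, …, x, …, bₙ)`, with `x` in the place `i`, is a derivation. -/
noncomputable def jacobianDerivation (b : Fin n → L) (i : Fin n) : Derivation k L L :=
  ((B.det.toMultilinearMap).toLinearMap (fun j => KaehlerDifferential.D k L (b j)) i).compDer
    (KaehlerDifferential.D k L)

theorem jacobianDerivation_apply (b : Fin n → L) (i : Fin n) (x : L) :
    jacobianDerivation B b i x = jacobian B (Function.update b i x) := by
  change B.det (Function.update _ i _) = B.det _
  congr 1
  ext j
  by_cases h : j = i
  · subst h; simp
  · simp [h]

theorem jacobianDerivation_self (b : Fin n → L) (i : Fin n) :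
    jacobianDerivation B b i (b i) = jacobian B b := by
  rw [jacobianDerivation_apply, Function.update_eq_self]

theorem jacobianDerivation_of_ne (b : Fin n → L) {i j : Fin n} (h : j ≠ i) :
    jacobianDerivation B b i (b j) = 0 := by
  rw [jacobianDerivation_apply]
  refine B.det.map_eq_zero_of_eq _ (i := i) (j := j) ?_ h.symm
  simp [h]

variable {B} (p : ℕ) [Fact p.Prime]

theorem zero_mem_monomials (a : Fin n → L) : (0 : L) ∈ monomials p a :=
  ⟨0, 0, fun _ => (Fact.out : p.Prime).pos, by simp [(Fact.out : p.Prime).ne_zero]⟩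

variable [CharP L p]

omit [Fact p.Prime] in
/-- For `bⱼ = cⱼ ^ p * a ^ Iⱼ`, the form `db₁ ∧ ⋯ ∧ dbₙ` is `det I * ∏ bⱼ` times the logarithmic
form of the `aᵢ`. -/
theorem jacobian_monomials (ha : ∀ i, B i = KaehlerDifferential.D k L (a i))
    (c : Fin n → L) (I : Fin n → Fin n → ℕ) :
    jacobian B (fun j => c j ^ p * ∏ i, a i ^ I j i) =
      (∏ j, (c j ^ p * ∏ i, a i ^ I j i)) * (∏ i, (a i)⁻¹) *
        (((Matrix.of fun i j => (I j i : ℤ)).det : ℤ) : L) := by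
  classical
  rw [jacobian, Module.Basis.det_apply]
  have : B.toMatrix (fun j => KaehlerDifferential.D k L (c j ^ p * ∏ i, a i ^ I j i)) =
      Matrix.of fun i j => (a i)⁻¹ * (Matrix.of fun i j =>
        (c j ^ p * ∏ i, a i ^ I j i) * (Matrix.of fun i j => ((I j i : ℤ) : L)) i j) i j := by
    ext i j
    rw [Module.Basis.toMatrix_apply]
    change partialDeriv B i _ = _
    rw [derivation_pow_char_mul, partialDeriv_prod ha]
    simp only [Matrix.of_apply, Int.cast_natCast]
    ring
  rw [this, Matrix.det_mul_column, Matrix.det_mul_row]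
  have h2 : (((Matrix.of fun i j => (I j i : ℤ)).det : ℤ) : L) =
      (Matrix.of fun i j => ((I j i : ℤ) : L)).det := by
    rw [← eq_intCast (Int.castRingHom L), RingHom.map_det]
    rfl
  rw [h2]
  ring

/-- Induction over tuples, for properties that are additive in each entry. -/
theorem tuple_induction {M : Type*} [AddCommMonoid M] {s : Set M} (h0 : 0 ∈ s)
    (hs : AddSubmonoid.closure s = ⊤) (P : (Fin n → M) → Prop)
    (hP : ∀ b, (∀ j, b j ∈ s) → P b)
    (hadd : ∀ b i x y, P (Function.update b i x) → P (Function.update b i y) →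
      P (Function.update b i (x + y))) (b : Fin n → M) : P b := by
  suffices h : ∀ S : Finset (Fin n), ∀ b : Fin n → M, (∀ j ∉ S, b j ∈ s) → P b from
    h Finset.univ b (by simp)
  intro S
  induction S using Finset.induction_on with
  | empty => exact fun b hb => hP b fun j => hb j (by simp)
  | insert i S hi ih =>
    intro b hb
    have key : ∀ x ∈ AddSubmonoid.closure s, P (Function.update b i x) := by
      intro x hx
      have hmem : ∀ x ∈ s, P (Function.update b i x) := fun x hx => ih _ fun j hj => by
        by_cases hji : j = i
        · subst hji; simpa using hx
        · rw [Function.update_of_ne hji]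
          exact hb j (by simp [hj, hji])
      induction hx using AddSubmonoid.closure_induction with
      | zero => exact hmem 0 h0
      | add x y _ _ hx hy => exact hadd b i x y hx hy
      | mem x hx => exact hmem x hx
    have := key (b i) (hs ▸ AddSubmonoid.mem_top _)
    rwa [Function.update_eq_self] at this

omit [CharP L p] in
/-- If `C` is a `p⁻¹`-linear map that kills the forms `x ^ m W dx` with `m < p - 1`, then
`x ↦ C (x ^ (p - 1) W dx)` is additive: it satisfies the Leibniz rule, and its values at `z` and at
`z + 1` agree. -/
theorem additive_of_derivation (C : L →+ L) (hC : ∀ f g, C (f ^ p * g) = f * C g)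
    (D : Derivation k L L) (W : L) (h : ∀ x m, m < p - 1 → C (x ^ m * W * D x) = 0) (x y : L) :
    C ((x + y) ^ (p - 1) * W * D (x + y)) =
      C (x ^ (p - 1) * W * D x) + C (y ^ (p - 1) * W * D y) := by
  have hp : p.Prime := Fact.out
  have hp1 : p - 1 + 1 = p := Nat.sub_add_cancel hp.one_le
  have hpow : ∀ x : L, x ^ p = x ^ (p - 1) * x := fun x => by rw [← pow_succ, hp1]
  have leib : ∀ x y : L, C ((x * y) ^ (p - 1) * W * D (x * y)) =
      x * C (y ^ (p - 1) * W * D y) + y * C (x ^ (p - 1) * W * D x) := by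
    intro x y
    rw [← hC, ← hC, ← map_add, D.leibniz, hpow, hpow, smul_eq_mul, smul_eq_mul]
    congr 1
    ring
  have succ : ∀ z : L, C ((z + 1) ^ (p - 1) * W * D (z + 1)) = C (z ^ (p - 1) * W * D z) := by
    intro z
    rw [map_add, D.map_one_eq_zero, add_zero, add_pow, Finset.sum_range_succ, add_mul, add_mul,
      Finset.sum_mul, Finset.sum_mul, map_add, map_sum, Finset.sum_eq_zero, zero_add]
    · simp
    · intro m hm
      rw [Finset.mem_range] at hm
      have : z ^ m * 1 ^ (p - 1 - m) * ((p - 1).choose m : L) * W * D z =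
          (p - 1).choose m • (z ^ m * W * D z) := by
        rw [nsmul_eq_mul]; ring
      rw [this, map_nsmul, h z m hm, nsmul_zero]
  by_cases hy : y = 0
  · subst hy; simp
  have e1 : x + y = y * (x / y + 1) := by field_simp
  have e2 : x = y * (x / y) := by field_simp
  rw [e1, leib, succ]
  conv_rhs => rw [e2, leib]
  ring

variable {p} (C : L →+ L) (hC : ∀ f g, C (f ^ p * g) = f * C g)
  (ha : ∀ i, B i = KaehlerDifferential.D k L (a i))
  (hC1 : C (∏ i, a i ^ (p - 1)) = 1)
  (hC0 : ∀ I : Fin n → ℕ, (∀ i, I i < p) → (∃ i, I i ≠ p - 1) → C (∏ i, a i ^ I i) = 0)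

theorem inv_eq_inv_pow_mul {x : L} (hx : x ≠ 0) {m : ℕ} (hm : 1 ≤ m) :
    x⁻¹ = x⁻¹ ^ m * x ^ (m - 1) := by
  obtain ⟨r, rfl⟩ := Nat.exists_eq_add_of_le' hm
  rw [pow_succ, Nat.add_sub_cancel, mul_right_comm, ← mul_pow, inv_mul_cancel₀ hx, one_pow,
    one_mul]

omit [CharP L p] in
include hC hC0 in
theorem cartier_prod_eq_zero (N : Fin n → ℕ) (hN : ∃ i, ¬ p ∣ N i + 1) :
    C (∏ i, a i ^ N i) = 0 := by
  have hp : p.Prime := Fact.out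
  have : ∏ i, a i ^ N i = (∏ i, a i ^ (N i / p)) ^ p * ∏ i, a i ^ (N i % p) := by
    rw [← Finset.prod_pow, ← Finset.prod_mul_distrib]
    refine Finset.prod_congr rfl fun i _ => ?_
    rw [← pow_mul, ← pow_add, Nat.div_add_mod']
  rw [this, hC, hC0 _ (fun i => Nat.mod_lt _ hp.pos), mul_zero]
  obtain ⟨i, hi⟩ := hN
  refine ⟨i, fun h => hi ⟨N i / p + 1, ?_⟩⟩
  have h1 := Nat.div_add_mod (N i) p
  have h2 := hp.one_le
  rw [mul_add]
  omega

omit [CharP L p] in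
include hC hC1 in
theorem cartier_prod_inv (h0 : ∀ i, a i ≠ 0) : C (∏ i, (a i)⁻¹) = ∏ i, (a i)⁻¹ := by
  have hp : p.Prime := Fact.out
  have : ∏ i, (a i)⁻¹ = (∏ i, (a i)⁻¹) ^ p * ∏ i, a i ^ (p - 1) := by
    rw [← Finset.prod_pow, ← Finset.prod_mul_distrib]
    refine Finset.prod_congr rfl fun i _ => ?_
    exact inv_eq_inv_pow_mul (h0 i) hp.one_le
  conv_lhs => rw [this, hC, hC1, mul_one]

theorem map_intCast_mul (C : L →+ L) (z : ℤ) (x : L) : C (x * z) = C x * z := by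
  rw [mul_comm, ← zsmul_eq_mul, map_zsmul, zsmul_eq_mul, mul_comm]

include hC ha hC0 in
/-- The Cartier operator kills exact forms. For monomials, it kills a logarithmic form times
`a ^ N` unless `p` divides `N`, and then the determinant of the exponents vanishes. -/
theorem cartier_jacobian [PerfectField k] [Algebra.EssFiniteType k L] (hn : 0 < n)
    (b : Fin n → L) : C (jacobian B b) = 0 := by
  classical
  have hp : p.Prime := Fact.out
  refine tuple_induction (zero_mem_monomials p a) (closure_monomials p ha)
    (fun b => C (jacobian B b) = 0) ?_ ?_ b
  · intro b hb
    choose c I hI hb using hb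
    obtain rfl : b = fun j => c j ^ p * ∏ i, a i ^ I j i := funext hb
    rw [jacobian_monomials p ha, map_intCast_mul, Finset.prod_mul_distrib, Finset.prod_pow,
      mul_assoc, hC, Finset.prod_comm]
    by_cases hN : ∀ i, p ∣ ∑ j, I j i
    · have hdet : (((Matrix.of fun i j => (I j i : ℤ)).det : ℤ) : L) = 0 := by
        rw [← eq_intCast (Int.castRingHom L), RingHom.map_det]
        refine Matrix.exists_mulVec_eq_zero_iff.mp ⟨fun _ => 1, ?_, ?_⟩
        · exact fun h => one_ne_zero (congrFun h ⟨0, hn⟩)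
        · ext i
          have := (CharP.cast_eq_zero_iff L p _).mpr (hN i)
          simpa [Matrix.mulVec, dotProduct] using this
      rw [hdet, mul_zero]
    · push Not at hN
      obtain ⟨i₀, hi₀⟩ := hN
      have h0 := ne_zero_of_basis ha
      have : (∏ i, ∏ j, a i ^ I j i) * ∏ i, (a i)⁻¹ =
          (∏ i, (a i)⁻¹) ^ p * ∏ i, a i ^ (∑ j, I j i + (p - 1)) := by
        rw [← Finset.prod_pow, ← Finset.prod_mul_distrib, ← Finset.prod_mul_distrib]
        refine Finset.prod_congr rfl fun i _ => ?_
        rw [Finset.prod_pow_eq_pow_sum, pow_add, mul_left_comm,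
          ← inv_eq_inv_pow_mul (h0 i) hp.one_le]
      rw [this, hC, cartier_prod_eq_zero C hC hC0, mul_zero, mul_zero, zero_mul]
      refine ⟨i₀, ?_⟩
      rw [add_assoc, Nat.sub_add_cancel hp.one_le]
      simpa using hi₀
  · intro b i x y hx hy
    rw [← jacobianDerivation_apply] at hx hy ⊢
    rw [map_add, map_add, hx, hy, add_zero]

include hC ha hC0 in
theorem cartier_pow_mul_jacobian_eq_zero [PerfectField k] [Algebra.EssFiniteType k L]
    (b : Fin n → L) (m : Fin n → ℕ) (hm : ∃ i, ¬ p ∣ m i + 1) :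
    C ((∏ i, b i ^ m i) * jacobian B b) = 0 := by
  classical
  obtain ⟨i, hi⟩ := hm
  -- the form is a multiple of the exact form obtained by replacing `bᵢ` with its antiderivative
  have h := cartier_jacobian C hC ha hC0 (Fin.pos i)
    (Function.update b i (b i ^ (m i + 1) * ∏ j ∈ Finset.univ.erase i, b j ^ m j))
  have h0 : jacobianDerivation B b i (∏ j ∈ Finset.univ.erase i, b j ^ m j) = 0 :=
    derivation_prod_eq_zero _ _ _ _ fun j hj =>
      jacobianDerivation_of_ne B b (Finset.ne_of_mem_erase hj)
  rw [← jacobianDerivation_apply, Derivation.leibniz, h0, smul_zero, zero_add,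
    Derivation.leibniz_pow, jacobianDerivation_self, Nat.add_sub_cancel, smul_comm, map_nsmul,
    ← Nat.cast_smul_eq_nsmul L, smul_eq_zero] at h
  have h1 := h.resolve_left (by rwa [CharP.cast_eq_zero_iff L p])
  rw [← Finset.mul_prod_erase _ _ (Finset.mem_univ i)]
  rw [smul_eq_mul, smul_eq_mul] at h1
  rw [← h1]
  congr 1
  ring

include hC ha hC1 hC0 in
/-- The Cartier operator satisfies `C (∏ bᵢ ^ (p - 1) db₁ ∧ ⋯ ∧ dbₙ) = db₁ ∧ ⋯ ∧ dbₙ`, for all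
elements `bᵢ` of the field: both sides are additive in each `bᵢ`, and agree on monomials. -/
theorem cartier_pow_sub_one_mul_jacobian [PerfectField k] [Algebra.EssFiniteType k L]
    (b : Fin n → L) : C ((∏ i, b i ^ (p - 1)) * jacobian B b) = jacobian B b := by
  classical
  have hp : p.Prime := Fact.out
  have h0 := ne_zero_of_basis ha
  refine tuple_induction (zero_mem_monomials p a) (closure_monomials p ha)
    (fun b => C ((∏ i, b i ^ (p - 1)) * jacobian B b) = jacobian B b) ?_ ?_ b
  · intro b hb
    choose c I hI hb using hb
    obtain rfl : b = fun j => c j ^ p * ∏ i, a i ^ I j i := funext hb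
    rw [jacobian_monomials p ha, ← mul_assoc, map_intCast_mul]
    congr 1
    conv_rhs => rw [← cartier_prod_inv C hC hC1 h0, ← hC]
    congr 1
    rw [← mul_assoc, ← Finset.prod_mul_distrib, ← Finset.prod_pow]
    congr 2
    ext j
    exact pow_sub_one_mul hp.ne_zero _
  · intro b i x y hx hy
    have hW : ∀ z : L, ∀ m : ℕ,
        z ^ m * (∏ j ∈ Finset.univ.erase i, b j ^ (p - 1)) * jacobianDerivation B b i z =
        (∏ j, (Function.update b i z) j ^ (if j = i then m else p - 1)) *
          jacobian B (Function.update b i z) := by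
      intro z m
      rw [jacobianDerivation_apply, ← Finset.mul_prod_erase _ _ (Finset.mem_univ i)]
      congr 2
      · simp
      · refine Finset.prod_congr rfl fun j hj => ?_
        rw [if_neg (Finset.ne_of_mem_erase hj), Function.update_of_ne (Finset.ne_of_mem_erase hj)]
    have hW' := fun z => hW z (p - 1)
    simp only [ite_self] at hW'
    rw [← hW'] at hx hy ⊢
    rw [additive_of_derivation p C hC, hx, hy, ← jacobianDerivation_apply,
      ← jacobianDerivation_apply, ← jacobianDerivation_apply, map_add]
    intro z m hm
    rw [hW]
    refine cartier_pow_mul_jacobian_eq_zero C hC ha hC0 _ _ ⟨i, fun h => ?_⟩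
    rw [if_pos rfl] at h
    have := Nat.le_of_dvd (Nat.succ_pos _) h
    omega

end Independence

/-! ### The Cartier operator on top forms -/

section Forms

variable {k L : Type u} [Field k] [Field L] [Algebra k L]

variable (k) in
/-- The top form `db₁ ∧ ⋯ ∧ dbₙ`. -/
noncomputable def wedgeD (b : Fin (Module.finrank L Ω[L⁄k]) → L) : TopForms k L :=
  exteriorPower.ιMulti L (Module.finrank L Ω[L⁄k]) fun i => KaehlerDifferential.D k L (b i)

/-- The Cartier operator on top forms: the `p⁻¹`-linear map with
`C (b₁ ^ m₁ ⋯ bₙ ^ mₙ db₁ ∧ ⋯ ∧ dbₙ)` equal to `db₁ ∧ ⋯ ∧ dbₙ` if all `mᵢ` are `p - 1`, and to zero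
if some `mᵢ + 1` is not divisible by `p`. -/
structure IsCartierOperator (p : ℕ) (C : TopForms k L →+ TopForms k L) : Prop where
  pow_smul (f : L) (ω : TopForms k L) : C (f ^ p • ω) = f • C ω
  prod_smul (b : Fin (Module.finrank L Ω[L⁄k]) → L) :
    C ((∏ i, b i ^ (p - 1)) • wedgeD k b) = wedgeD k b
  prod_smul_eq_zero (b : Fin (Module.finrank L Ω[L⁄k]) → L)
    (m : Fin (Module.finrank L Ω[L⁄k]) → ℕ) (hm : ∃ i, ¬ p ∣ m i + 1) :
    C ((∏ i, b i ^ m i) • wedgeD k b) = 0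

section Basis

variable {B : Module.Basis (Fin (Module.finrank L Ω[L⁄k])) L Ω[L⁄k]}
  {a : Fin (Module.finrank L Ω[L⁄k]) → L} (ha : ∀ i, B i = KaehlerDifferential.D k L (a i))

include ha

theorem ιMulti_eq_det_smul_wedgeD (v : Fin (Module.finrank L Ω[L⁄k]) → Ω[L⁄k]) :
    exteriorPower.ιMulti L (Module.finrank L Ω[L⁄k]) v = B.det v • wedgeD k a := by
  have h : (fun i => KaehlerDifferential.D k L (a i)) = B := funext fun i => (ha i).symm
  rw [wedgeD, h]
  have : exteriorPower.ιMulti L (Module.finrank L Ω[L⁄k]) =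
      (LinearMap.toSpanSingleton L (TopForms k L)
        (exteriorPower.ιMulti L (Module.finrank L Ω[L⁄k]) B)).compAlternatingMap B.det := by
    refine B.ext_alternating fun σ hσ => ?_
    let e := Equiv.ofBijective σ (Finite.injective_iff_bijective.mp hσ)
    have h2 : (fun i => B (σ i)) = B ∘ e := rfl
    rw [h2, AlternatingMap.map_perm, AlternatingMap.map_perm]
    simp [Module.Basis.det_self]
  conv_lhs => rw [this]
  rfl

theorem wedgeD_eq_jacobian_smul (b : Fin (Module.finrank L Ω[L⁄k]) → L) :
    wedgeD k b = jacobian B b • wedgeD k a :=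
  ιMulti_eq_det_smul_wedgeD ha _

theorem exists_eq_smul_wedgeD (ω : TopForms k L) : ∃ g : L, ω = g • wedgeD k a := by
  have h : ω ∈ Submodule.span L
      (Set.range (exteriorPower.ιMulti L (M := Ω[L⁄k]) (Module.finrank L Ω[L⁄k]))) := by
    rw [exteriorPower.ιMulti_span]; trivial
  induction h using Submodule.span_induction with
  | mem x hx =>
    obtain ⟨v, rfl⟩ := hx
    exact ⟨_, ιMulti_eq_det_smul_wedgeD ha v⟩
  | zero => exact ⟨0, by rw [zero_smul]⟩
  | add x y _ _ hx hy =>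
    obtain ⟨g, rfl⟩ := hx
    obtain ⟨h, rfl⟩ := hy
    exact ⟨g + h, by rw [add_smul]⟩
  | smul c x _ hx =>
    obtain ⟨g, rfl⟩ := hx
    exact ⟨c * g, by rw [mul_smul]⟩

end Basis

theorem exists_basis_of_wedgeD_ne_zero [Algebra.EssFiniteType k L]
    {b : Fin (Module.finrank L Ω[L⁄k]) → L}
    (hb : wedgeD k b ≠ 0) : ∃ B : Module.Basis (Fin (Module.finrank L Ω[L⁄k])) L Ω[L⁄k],
      ∀ i, B i = KaehlerDifferential.D k L (b i) := by
  have hli : LinearIndependent L fun i => KaehlerDifferential.D k L (b i) := by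
    by_contra h
    exact hb (AlternatingMap.map_linearDependent _ _ h)
  refine ⟨Module.Basis.mk hli ?_, fun i => Module.Basis.mk_apply _ _ i⟩
  rw [hli.span_eq_top_of_card_eq_finrank' (by simp)]

variable (p : ℕ) [Fact p.Prime] [CharP L p] [PerfectField k] [Algebra.EssFiniteType k L]

variable (k L) in
theorem exists_isCartierOperator :
    ∃ C : TopForms k L →+ TopForms k L, IsCartierOperator p C := by
  obtain ⟨B, a, ha⟩ := exists_basis_kaehlerDifferential k L
  obtain ⟨C, hC, hC1, hC0, -⟩ := exists_cartier_coordinates p ha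
  let δ : TopForms k L →ₗ[L] L := exteriorPower.alternatingMapLinearEquiv B.det
  have hδ : δ (wedgeD k a) = 1 := by
    have h2 : (fun i => KaehlerDifferential.D k L (a i)) = B := funext fun i => (ha i).symm
    change exteriorPower.alternatingMapLinearEquiv B.det (wedgeD k a) = 1
    rw [wedgeD, exteriorPower.alternatingMapLinearEquiv_apply_ιMulti, h2, Module.Basis.det_self]
  refine ⟨AddMonoidHom.mk' (fun ω => C (δ ω) • wedgeD k a) fun x y => ?_, ?_, ?_, ?_⟩
  · rw [map_add, map_add, add_smul]
  · intro f ω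
    simp only [AddMonoidHom.mk'_apply]
    rw [map_smul, smul_eq_mul, hC, mul_smul]
  · intro b
    simp only [AddMonoidHom.mk'_apply]
    rw [wedgeD_eq_jacobian_smul ha b, δ.map_smul, δ.map_smul, hδ, smul_eq_mul, smul_eq_mul, mul_one,
      cartier_pow_sub_one_mul_jacobian C hC ha hC1 hC0]
  · intro b m hm
    simp only [AddMonoidHom.mk'_apply]
    rw [wedgeD_eq_jacobian_smul ha b, δ.map_smul, δ.map_smul, hδ, smul_eq_mul, smul_eq_mul, mul_one,
      cartier_pow_mul_jacobian_eq_zero C hC ha hC0 b m hm, zero_smul]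

namespace IsCartierOperator

variable {p} {C : TopForms k L →+ TopForms k L} (hC : IsCartierOperator p C)

include hC

omit [Fact p.Prime] [CharP L p] [PerfectField k] [Algebra.EssFiniteType k L] in
/-- The coefficient of `b ^ J` in the expansion of `f` in the `p`-basis `b` is obtained by applying
the Cartier operator to `b ^ (p - 1 - J) f db₁ ∧ ⋯ ∧ dbₙ`. -/
theorem map_sum_smul (b : Fin (Module.finrank L Ω[L⁄k]) → L)
    (c : (Fin (Module.finrank L Ω[L⁄k]) → Fin p) → L)
    (J : Fin (Module.finrank L Ω[L⁄k]) → Fin p) :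
    C (((∏ i, b i ^ (p - 1 - (J i : ℕ))) * ∑ I, c I ^ p * ∏ i, b i ^ (I i : ℕ)) • wedgeD k b) =
      c J • wedgeD k b := by
  classical
  rw [Finset.mul_sum, Finset.sum_smul, map_sum, Finset.sum_eq_single J]
  · rw [mul_left_comm, mul_smul, hC.pow_smul, ← Finset.prod_mul_distrib]
    have : ∀ i, b i ^ (p - 1 - (J i : ℕ)) * b i ^ (J i : ℕ) = b i ^ (p - 1) := fun i => by
      rw [← pow_add, Nat.sub_add_cancel (Nat.le_sub_one_of_lt (J i).2)]
    simp only [this]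
    rw [hC.prod_smul]
  · intro I _ hI
    obtain ⟨i, hi⟩ := Function.ne_iff.mp hI
    rw [mul_left_comm, mul_smul, hC.pow_smul, ← Finset.prod_mul_distrib]
    simp only [← pow_add]
    rw [hC.prod_smul_eq_zero, smul_zero]
    refine ⟨i, fun h => hi (Fin.ext ?_)⟩
    have h1 := (I i).2
    have h2 := (J i).2
    obtain ⟨t, ht⟩ := h
    have h3 : p - 1 - (J i : ℕ) + I i + 1 = p + I i - J i := by omega
    rw [h3] at ht
    have ht0 : 0 < t := by
      rcases Nat.eq_zero_or_pos t with h | h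
      · rw [h, mul_zero] at ht; omega
      · exact h
    have ht2 : t < 2 := by
      by_contra h
      have := Nat.mul_le_mul_left p (show 2 ≤ t by omega)
      omega
    obtain rfl : t = 1 := by omega
    omega
  · intro h; exact absurd (Finset.mem_univ J) h

/-- Let `A` be a normal subring stable under the derivations `∂/∂bᵢ`. Then the Cartier operator
preserves `A db₁ ∧ ⋯ ∧ dbₙ`. -/
theorem map_smul_wedgeD_mem {B : Module.Basis (Fin (Module.finrank L Ω[L⁄k])) L Ω[L⁄k]}
    {b : Fin (Module.finrank L Ω[L⁄k]) → L} (hb : ∀ i, B i = KaehlerDifferential.D k L (b i))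
    (A : AddSubgroup L) (hA : ∀ i, ∀ x ∈ A, partialDeriv B i x ∈ A)
    (hA' : ∀ x : L, x ^ p ∈ A → x ∈ A) {f : L} (hf : f ∈ A) :
    ∃ g ∈ A, C (f • wedgeD k b) = g • wedgeD k b := by
  obtain ⟨C', h1, h2, h3, h4⟩ := exists_cartier_coordinates p hb
  refine ⟨C' f, hA' _ (h4 A hA f hf), ?_⟩
  have hf' : f ∈ AddSubmonoid.closure (monomials p b) :=
    closure_monomials p hb ▸ AddSubmonoid.mem_top f
  clear hf
  induction hf' using AddSubmonoid.closure_induction with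
  | zero => rw [zero_smul, map_zero, map_zero, zero_smul]
  | add x y _ _ hx hy => rw [add_smul, map_add, map_add, add_smul, hx, hy]
  | mem x hx =>
    obtain ⟨c, I, hI, rfl⟩ := hx
    rw [mul_smul, hC.pow_smul, h1]
    by_cases h : ∀ i, I i = p - 1
    · simp only [h]
      rw [h2, hC.prod_smul, mul_one]
    · push Not at h
      obtain ⟨i, hi⟩ := h
      rw [h3 I hI ⟨i, hi⟩, hC.prod_smul_eq_zero, smul_zero, mul_zero, zero_smul]
      refine ⟨i, fun h => hi ?_⟩
      have := Nat.le_of_dvd (Nat.succ_pos _) h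
      have := hI i
      omega

/-- Duality: every `p⁻¹`-linear map `L → L` is given by the Cartier operator and multiplication with
an element of `L`. -/
theorem exists_smul_eq {ω : TopForms k L} (hω : ω ≠ 0) (φ : L →+ L)
    (hφ : ∀ r x, φ (r ^ p * x) = r * φ x) :
    ∃ h : L, ∀ f, φ f • ω = C ((f * h) • ω) := by
  have hp : p.Prime := Fact.out
  obtain ⟨B, b, hb⟩ := exists_basis_kaehlerDifferential k L
  obtain ⟨g, rfl⟩ := exists_eq_smul_wedgeD hb ω
  have hg : g ≠ 0 := by rintro rfl; exact hω (zero_smul _ _)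
  let h₀ : L := ∑ I : Fin (Module.finrank L Ω[L⁄k]) → Fin p,
    φ (∏ i, b i ^ (I i : ℕ)) ^ p * ∏ i, b i ^ (p - 1 - (I i : ℕ))
  have key : ∀ J : Fin (Module.finrank L Ω[L⁄k]) → Fin p,
      C (((∏ i, b i ^ (J i : ℕ)) * h₀) • wedgeD k b) =
        φ (∏ i, b i ^ (J i : ℕ)) • wedgeD k b := by
    intro J
    have h1 := hC.map_sum_smul b (fun I => φ (∏ i, b i ^ (Fin.rev (I i) : ℕ)))
      (fun i => Fin.rev (J i))
    simp only [Fin.rev_rev] at h1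
    rw [← h1]
    congr 3
    · refine Finset.prod_congr rfl fun i _ => ?_
      rw [Fin.val_rev]
      congr 1
      have := (J i).2
      omega
    · refine Fintype.sum_equiv (Equiv.arrowCongr (Equiv.refl _) Fin.revPerm) _ _ fun I => ?_
      simp only [Equiv.arrowCongr_apply, Equiv.coe_refl, Function.comp, Equiv.refl_symm, id,
        Fin.revPerm_apply, Fin.rev_rev]
      congr 1
      refine Finset.prod_congr rfl fun i _ => ?_
      rw [Fin.val_rev]
      congr 1
      have := (I i).2
      omega
  refine ⟨h₀ * g ^ (p - 1), fun f => ?_⟩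
  have e : (f * (h₀ * g ^ (p - 1))) • g • wedgeD k b = g ^ p • ((f * h₀) • wedgeD k b) := by
    rw [smul_smul, smul_smul]
    congr 1
    rw [← pow_sub_one_mul hp.ne_zero g]
    ring
  rw [e, hC.pow_smul, smul_comm]
  congr 1
  obtain ⟨c, rfl⟩ := exists_eq_sum_monomials p (closure_monomials p hb) f
  rw [map_sum, Finset.sum_mul, Finset.sum_smul, Finset.sum_smul, map_sum]
  refine Finset.sum_congr rfl fun J _ => ?_
  rw [hφ, mul_assoc, mul_smul, mul_smul, hC.pow_smul, key]

end IsCartierOperator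

end Forms

/-! ### The Cartier operator and regular forms on local rings -/

section Local

variable {k L : Type u} [Field k] [Field L] [Algebra k L]

/-- A generator of the regular top forms of a local ring may be chosen as `db₁ ∧ ⋯ ∧ dbₙ`:
otherwise all these forms lie in `𝔪 η`, and hence so does `η`. -/
theorem IsGenerator.exists_wedgeD {A : Type u} [CommRing A] [IsLocalRing A] [Algebra A L]
    [FaithfulSMul A L] {η : TopForms k L} (hη : IsGenerator k L A η) (hη0 : η ≠ 0) :
    ∃ (b : Fin (Module.finrank L Ω[L⁄k]) → A) (v : Aˣ),
      wedgeD k (fun i => algebraMap A L (b i)) = algebraMap A L v • η := by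
  by_contra! h
  have hmem : η ∈ regularForms k L A := (hη η).mpr ⟨1, by rw [map_one, one_smul]⟩
  obtain ⟨m, hm, hme⟩ : ∃ m ∈ IsLocalRing.maximalIdeal A, η = algebraMap A L m • η := by
    unfold regularForms at hmem
    generalize hω : η = ω at hmem
    conv => enter [1, m, 2]; rw [← hω]; lhs; rw [hω]
    clear hω
    induction hmem using AddSubgroup.closure_induction with
    | mem x hx =>
      obtain ⟨c, b, rfl⟩ := hx
      obtain ⟨d, hd⟩ := (hη (wedgeD k fun i => algebraMap A L (b i))).mp
        (AddSubgroup.subset_closure ⟨1, b, by rw [map_one, one_smul]; rfl⟩)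
      have hdm : d ∈ IsLocalRing.maximalIdeal A := by
        rw [IsLocalRing.mem_maximalIdeal]
        intro hu
        exact h b hu.unit hd
      exact ⟨c * d, Ideal.mul_mem_left _ _ hdm, by rw [map_mul, mul_smul, ← hd]; rfl⟩
    | zero => exact ⟨0, zero_mem _, by rw [map_zero, zero_smul]⟩
    | add x y _ _ hx hy =>
      obtain ⟨c, hc, rfl⟩ := hx
      obtain ⟨d, hd, rfl⟩ := hy
      exact ⟨c + d, add_mem hc hd, by rw [map_add, add_smul]⟩
    | neg x _ hx =>
      obtain ⟨c, hc, rfl⟩ := hx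
      exact ⟨-c, neg_mem hc, by rw [map_neg]; exact (neg_smul _ _).symm⟩
  have h2 : algebraMap A L m = algebraMap A L 1 :=
    smul_left_injective L hη0 (by simp only [map_one, one_smul]; exact hme.symm)
  rw [FaithfulSMul.algebraMap_injective A L h2] at hm
  exact (Ideal.ne_top_iff_one _).mp (IsLocalRing.maximalIdeal.isMaximal A).ne_top hm

namespace IsCartierOperator

variable {p : ℕ} [Fact p.Prime] [CharP L p] [PerfectField k] [Algebra.EssFiniteType k L]
  {C : TopForms k L →+ TopForms k L} (hC : IsCartierOperator p C)

include hC

/-- The Cartier operator preserves the regular top forms on a normal local ring for which these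
are generated by one form. -/
theorem exists_map_smul_eq {A : Type u} [CommRing A] [IsDomain A] [IsLocalRing A]
    [IsIntegrallyClosed A] [Algebra A L] [IsFractionRing A L] {η : TopForms k L}
    (hη : IsGenerator k L A η) (hη0 : η ≠ 0) (x : A) :
    ∃ y : A, C (algebraMap A L x • η) = algebraMap A L y • η := by
  classical
  obtain ⟨b, v, hbv⟩ := hη.exists_wedgeD hη0
  have hinj := FaithfulSMul.algebraMap_injective A L
  have hv : algebraMap A L (v⁻¹ : Aˣ) * algebraMap A L v = 1 := by
    rw [← map_mul, Units.inv_mul, map_one]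
  have hη1 : η = algebraMap A L (v⁻¹ : Aˣ) • wedgeD k (fun i => algebraMap A L (b i)) := by
    rw [hbv, smul_smul, hv, one_smul]
  have hne : wedgeD k (fun i => algebraMap A L (b i)) ≠ 0 := by
    intro h0
    rw [h0, smul_zero] at hη1
    exact hη0 hη1
  obtain ⟨B, hB⟩ := exists_basis_of_wedgeD_ne_zero hne
  -- by Cramer's rule, `∂f/∂bᵢ` is the quotient of two regular forms, the second a generator
  have hA : ∀ i, ∀ z ∈ (algebraMap A L).range.toAddSubgroup,
      partialDeriv B i z ∈ (algebraMap A L).range.toAddSubgroup := by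
    rintro i _ ⟨z, rfl⟩
    obtain ⟨d, hd⟩ := (hη (wedgeD k (fun j => algebraMap A L (Function.update b i z j)))).mp
      (AddSubgroup.subset_closure ⟨1, _, by rw [map_one, one_smul]; rfl⟩)
    rw [hη1, smul_smul, ← map_mul, wedgeD_eq_jacobian_smul hB] at hd
    have hd' := smul_left_injective L hne hd
    refine ⟨_, hd'.symm.trans ?_⟩
    have : (fun j => algebraMap A L (Function.update b i z j)) =
        Function.update (fun j => algebraMap A L (b j)) i (algebraMap A L z) := by
      ext j
      by_cases h : j = i
      · subst h; simp
      · simp [h]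
    rw [this, ← jacobianDerivation_apply]
    -- both sides are derivations with the same values at the `bⱼ`
    change (B.det.toMultilinearMap).toLinearMap _ i (KaehlerDifferential.D k L _) =
      B.coord i (KaehlerDifferential.D k L _)
    congr 1
    refine B.ext fun j => ?_
    rw [hB]
    change jacobianDerivation B (fun j => algebraMap A L (b j)) i _ = partialDeriv B i _
    rw [partialDeriv_self hB]
    split_ifs with h
    · subst h
      rw [jacobianDerivation_self B (fun j => algebraMap A L (b j)), jacobian]
      simp only [← hB]
      exact B.det_self
    · exact jacobianDerivation_of_ne B (fun j => algebraMap A L (b j)) (Ne.symm h)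
  have hA' : ∀ z : L, z ^ p ∈ (algebraMap A L).range.toAddSubgroup →
      z ∈ (algebraMap A L).range.toAddSubgroup := by
    rintro z ⟨w, hw⟩
    exact IsIntegrallyClosed.exists_algebraMap_eq_of_isIntegral_pow (Fact.out : p.Prime).pos
      (hw ▸ isIntegral_algebraMap)
  obtain ⟨g, ⟨y, rfl⟩, hg⟩ := hC.map_smul_wedgeD_mem hB _ hA hA'
    (f := algebraMap A L (x * (v⁻¹ : Aˣ))) ⟨_, rfl⟩
  refine ⟨y * v, ?_⟩
  conv_lhs => rw [hη1, smul_smul, ← map_mul, hg, hbv, smul_smul, ← map_mul]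

/-- The case `e = 1` of `mem_range_of_forall_iterate`: the hypothesis says that the coefficients of
`f` in a `p`-basis of regular functions are regular. -/
theorem mem_range_of_forall {A : Type u} [CommRing A] [IsDomain A] [IsLocalRing A]
    [Algebra A L] [IsFractionRing A L] {η : TopForms k L}
    (hη : IsGenerator k L A η) (hη0 : η ≠ 0) {f : L}
    (hf : ∀ x : A, ∃ y : A, C ((algebraMap A L x * f) • η) = algebraMap A L y • η) :
    f ∈ (algebraMap A L).range := by
  obtain ⟨b, v, hbv⟩ := hη.exists_wedgeD hη0
  have hv : algebraMap A L (v⁻¹ : Aˣ) * algebraMap A L v = 1 := by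
    rw [← map_mul, Units.inv_mul, map_one]
  have hη1 : η = algebraMap A L (v⁻¹ : Aˣ) • wedgeD k (fun i => algebraMap A L (b i)) := by
    rw [hbv, smul_smul, hv, one_smul]
  have hne : wedgeD k (fun i => algebraMap A L (b i)) ≠ 0 := by
    intro h0
    rw [h0, smul_zero] at hη1
    exact hη0 hη1
  obtain ⟨B, hB⟩ := exists_basis_of_wedgeD_ne_zero hne
  obtain ⟨c, hc⟩ := exists_eq_sum_monomials p (closure_monomials p hB) f
  rw [hc]
  refine sum_mem fun J _ => mul_mem (pow_mem ?_ _)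
    (prod_mem fun i _ => pow_mem ((algebraMap A L).mem_range_self _) _)
  have h1 := hC.map_sum_smul (fun i => algebraMap A L (b i)) c J
  rw [← hc] at h1
  obtain ⟨y, hy⟩ := hf ((∏ i, b i ^ (p - 1 - (J i : ℕ))) * v)
  have e : (algebraMap A L ((∏ i, b i ^ (p - 1 - (J i : ℕ))) * v) * f) • η =
      ((∏ i, algebraMap A L (b i) ^ (p - 1 - (J i : ℕ))) * f) •
        wedgeD k (fun i => algebraMap A L (b i)) := by
    rw [hbv, smul_smul, map_mul, map_prod]
    simp only [map_pow]
    congr 1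
    ring
  rw [e, h1, hη1, smul_smul, ← map_mul] at hy
  exact ⟨_, (smul_left_injective L hne hy).symm⟩

omit [Fact p.Prime] [CharP L p] [PerfectField k] in
theorem surjective : Function.Surjective C := by
  obtain ⟨B, b, hb⟩ := exists_basis_kaehlerDifferential k L
  intro ω
  obtain ⟨g, rfl⟩ := exists_eq_smul_wedgeD hb ω
  exact ⟨(g ^ p) • (∏ i, b i ^ (p - 1)) • wedgeD k b, by rw [hC.pow_smul, hC.prod_smul]⟩

omit [Fact p.Prime] [CharP L p] [PerfectField k] [Algebra.EssFiniteType k L] in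
theorem iterate_pow_smul (e : ℕ) (f : L) (ω : TopForms k L) :
    C^[e] (f ^ p ^ e • ω) = f • C^[e] ω := by
  induction e generalizing f ω with
  | zero => simp
  | succ e ih =>
    rw [Function.iterate_succ_apply, Function.iterate_succ_apply, pow_succ, pow_mul, hC.pow_smul,
      ih]

theorem exists_iterate_smul_eq_algebraMap_smul {A : Type u} [CommRing A] [IsDomain A]
    [IsLocalRing A] [IsIntegrallyClosed A] [Algebra A L] [IsFractionRing A L] {η : TopForms k L}
    (hη : IsGenerator k L A η) (hη0 : η ≠ 0) (e : ℕ) (x : A) :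
    ∃ y : A, C^[e] (algebraMap A L x • η) = algebraMap A L y • η := by
  induction e generalizing x with
  | zero => exact ⟨x, rfl⟩
  | succ e ih =>
    obtain ⟨y, hy⟩ := hC.exists_map_smul_eq hη hη0 x
    rw [Function.iterate_succ_apply, hy]
    exact ih y

omit [Fact p.Prime] [CharP L p] [PerfectField k] hC in
theorem exists_eq_smul {η : TopForms k L} (hη0 : η ≠ 0) (ω : TopForms k L) :
    ∃ g : L, ω = g • η := by
  obtain ⟨B, b, hb⟩ := exists_basis_kaehlerDifferential k L
  obtain ⟨g, rfl⟩ := exists_eq_smul_wedgeD hb ω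
  obtain ⟨h, rfl⟩ := exists_eq_smul_wedgeD hb η
  have hh : h ≠ 0 := by rintro rfl; exact hη0 (zero_smul _ _)
  exact ⟨g * h⁻¹, by rw [smul_smul, inv_mul_cancel_right₀ hh]⟩

/-- The iterated Cartier operator generates the module of `p⁻ᵉ`-linear maps of the local ring:
multiplication with `f` followed by it is only regular if `f` is. -/
theorem mem_range_of_forall_iterate {A : Type u} [CommRing A] [IsDomain A] [IsLocalRing A]
    [Algebra A L] [IsFractionRing A L] {η : TopForms k L}
    (hη : IsGenerator k L A η) (hη0 : η ≠ 0) (e : ℕ) {f : L}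
    (hf : ∀ x : A, ∃ y : A, C^[e] ((algebraMap A L x * f) • η) = algebraMap A L y • η) :
    f ∈ (algebraMap A L).range := by
  induction e generalizing f with
  | zero =>
    obtain ⟨y, hy⟩ := hf 1
    rw [map_one, one_mul] at hy
    exact ⟨y, (smul_left_injective L hη0 hy).symm⟩
  | succ e ih =>
    refine hC.mem_range_of_forall hη hη0 fun x => ?_
    obtain ⟨g, hg⟩ := exists_eq_smul hη0 (C ((algebraMap A L x * f) • η))
    obtain ⟨y, rfl⟩ : g ∈ (algebraMap A L).range := by
      refine ih fun z => ?_
      obtain ⟨y, hy⟩ := hf (z ^ p * x)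
      refine ⟨y, ?_⟩
      rw [mul_smul, ← hg, ← hC.pow_smul, ← Function.iterate_succ_apply C, smul_smul, ← hy,
        ← mul_assoc, map_mul, map_pow]
    exact ⟨y, hg⟩

/-- Duality for the iterated Cartier operator. -/
theorem exists_iterate_smul_eq {ω : TopForms k L} (hω : ω ≠ 0) (e : ℕ) (φ : L →+ L)
    (hφ : ∀ r x, φ (r ^ p ^ e * x) = r * φ x) :
    ∃ h : L, ∀ f, φ f • ω = C^[e] ((f * h) • ω) := by
  have hp : p.Prime := Fact.out
  have : ExpChar L p := ExpChar.prime hp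
  induction e generalizing φ with
  | zero =>
    refine ⟨φ 1, fun f => ?_⟩
    have := hφ f 1
    simp only [pow_zero, pow_one, mul_one] at this
    rw [this]; rfl
  | succ e ih =>
    have huniq : ∀ h h' : L, (∀ g : L, C^[e] ((g * h) • ω) = C^[e] ((g * h') • ω)) → h = h' := by
      intro h h' hh
      by_contra hne
      have hsub : h - h' ≠ 0 := sub_ne_zero.mpr hne
      obtain ⟨τ, hτ⟩ := hC.surjective.iterate e ω
      obtain ⟨g, rfl⟩ := exists_eq_smul hω τ
      apply hω
      have h1 := hh (g * (h - h')⁻¹)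
      have h2 : g * (h - h')⁻¹ * h = g + g * (h - h')⁻¹ * h' := by field_simp; ring
      rw [h2, add_smul, iterate_map_add, hτ] at h1
      exact add_eq_right.mp h1
    let φ' : L → L →+ L := fun f => AddMonoidHom.mk' (fun g => φ (g ^ p * f)) fun x y => by
      rw [add_pow_expChar, add_mul, map_add]
    have hφ' : ∀ f r x, φ' f (r ^ p ^ e * x) = r * φ' f x := by
      intro f r x
      change φ ((r ^ p ^ e * x) ^ p * f) = r * φ (x ^ p * f)
      rw [← hφ, mul_pow, ← pow_mul, ← pow_succ, mul_assoc]
    choose H hH using fun f => ih (φ' f) (hφ' f)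
    have hH' : ∀ f g : L, φ (g ^ p * f) • ω = C^[e] ((g * H f) • ω) := hH
    let ψ : L →+ L := AddMonoidHom.mk' H fun x y => huniq _ _ fun g => by
      rw [← hH', mul_add, map_add, add_smul, hH', hH', ← iterate_map_add, ← add_smul, ← mul_add]
    obtain ⟨h, hh⟩ := hC.exists_smul_eq hω ψ fun r x => huniq _ _ fun g => by
      change C^[e] ((g * H (r ^ p * x)) • ω) = C^[e] ((g * (r * H x)) • ω)
      rw [← hH', ← mul_assoc, ← mul_assoc, ← hH', mul_pow]
    refine ⟨h, fun f => ?_⟩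
    rw [Function.iterate_succ_apply, ← hh]
    have := hH' f 1
    rw [one_pow, one_mul, one_mul] at this
    exact this

end IsCartierOperator

end Local

/-! ### Orders of rational functions -/

section Ord

variable {X : Scheme.{u}} [IsIntegral X] [IsLocallyNoetherian X]

theorem ord_one (x : X) : Scheme.ord (1 : X.functionField) x = 0 := by
  have := Scheme.ord_mul (x := x) (one_ne_zero (α := X.functionField)) one_ne_zero
  rw [mul_one] at this
  omega

theorem ord_inv {x : X} {f : X.functionField} (hf : f ≠ 0) :
    Scheme.ord f⁻¹ x = -Scheme.ord f x := by
  have := Scheme.ord_mul (x := x) hf (inv_ne_zero hf)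
  rw [mul_inv_cancel₀ hf, ord_one] at this
  omega

theorem ord_pow {x : X} {f : X.functionField} (hf : f ≠ 0) (n : ℕ) :
    Scheme.ord (f ^ n) x = n * Scheme.ord f x := by
  induction n with
  | zero => rw [pow_zero, ord_one]; simp
  | succ n ih =>
    rw [pow_succ, Scheme.ord_mul (pow_ne_zero _ hf) hf, ih]
    push_cast; ring

theorem ord_zpow {x : X} {f : X.functionField} (hf : f ≠ 0) (n : ℤ) :
    Scheme.ord (f ^ n) x = n * Scheme.ord f x := by
  obtain ⟨n, rfl | rfl⟩ := n.eq_nat_or_neg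
  · rw [zpow_natCast, ord_pow hf]
  · rw [zpow_neg, zpow_natCast, ord_inv (pow_ne_zero _ hf), ord_pow hf, neg_mul]

theorem ord_algebraMap_nonneg {x : X} (hx : coheight x = 1) {a : X.presheaf.stalk x} (ha : a ≠ 0) :
    0 ≤ Scheme.ord (algebraMap (X.presheaf.stalk x) X.functionField a) x := by
  have : Ring.KrullDimLE 1 (X.presheaf.stalk x) := krullDimLE_of_coheight_le hx.le
  have ha' : algebraMap (X.presheaf.stalk x) X.functionField a ≠ 0 := by
    rwa [map_ne_zero_iff _ (IsFractionRing.injective _ _)]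
  rw [Scheme.le_ord_iff hx ha']
  exact Ring.ordFrac_ge_one_of_ne_zero ha

variable [IsNormalScheme X]

theorem ord_algebraMap_eq_zero_iff {x : X} (hx : coheight x = 1) {a : X.presheaf.stalk x}
    (ha : a ≠ 0) :
    Scheme.ord (algebraMap (X.presheaf.stalk x) X.functionField a) x = 0 ↔ IsUnit a := by
  have := isDiscreteValuationRing_stalk X hx
  have : Ring.KrullDimLE 1 (X.presheaf.stalk x) := krullDimLE_of_coheight_le hx.le
  have ha' : algebraMap (X.presheaf.stalk x) X.functionField a ≠ 0 := by
    rwa [map_ne_zero_iff _ (IsFractionRing.injective _ _)]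
  rw [Scheme.ord_eq_iff hx ha',
    Ring.isUnit_iff_ordFrac_one_of_isDiscreteValuationRing (K := X.functionField)]
  rfl

theorem ord_nonneg_iff {x : X} (hx : coheight x = 1) {f : X.functionField} (hf : f ≠ 0) :
    0 ≤ Scheme.ord f x ↔ f ∈ (algebraMap (X.presheaf.stalk x) X.functionField).range := by
  have := isDiscreteValuationRing_stalk X hx
  constructor
  · intro h
    rcases ValuationRing.isInteger_or_isInteger (X.presheaf.stalk x) f with h1 | ⟨b, hb⟩
    · exact h1
    have hb0 : b ≠ 0 := by
      rintro rfl
      rw [map_zero, eq_comm, inv_eq_zero] at hb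
      exact hf hb
    have h2 := ord_algebraMap_nonneg hx hb0
    have h3 : Scheme.ord (algebraMap (X.presheaf.stalk x) X.functionField b) x = 0 := by
      rw [hb, ord_inv hf] at h2 ⊢
      omega
    obtain ⟨v, rfl⟩ := (ord_algebraMap_eq_zero_iff hx hb0).mp h3
    refine ⟨(v⁻¹ : (X.presheaf.stalk x)ˣ), ?_⟩
    rw [eq_comm, ← inv_inv f, ← hb]
    refine inv_eq_of_mul_eq_one_right ?_
    rw [← map_mul, Units.mul_inv, map_one]
  · rintro ⟨a, rfl⟩
    refine ord_algebraMap_nonneg hx ?_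
    rintro rfl
    exact hf (map_zero _)

theorem exists_ord_eq_one {x : X} (hx : coheight x = 1) :
    ∃ a : X.presheaf.stalk x, a ≠ 0 ∧
      Scheme.ord (algebraMap (X.presheaf.stalk x) X.functionField a) x = 1 := by
  have := isDiscreteValuationRing_stalk X hx
  have : Ring.KrullDimLE 1 (X.presheaf.stalk x) := krullDimLE_of_coheight_le hx.le
  obtain ⟨ϖ, hϖ⟩ := IsDiscreteValuationRing.exists_irreducible (X.presheaf.stalk x)
  have ha' : algebraMap (X.presheaf.stalk x) X.functionField ϖ ≠ 0 := by
    rw [map_ne_zero_iff _ (IsFractionRing.injective _ _)]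
    exact hϖ.ne_zero
  exact ⟨ϖ, hϖ.ne_zero, (Scheme.ord_eq_iff hx ha').mpr (Ring.ordFrac_irreducible hϖ)⟩

end Ord

/-! ### Birational morphisms and function fields -/

section FunctionField

variable {Y X : Scheme.{u}} [IsIntegral Y] [IsIntegral X] (π : Y ⟶ X)

theorem stalkSpecializes_functionFieldMap [IsDominant π] (y : Y) :
    X.presheaf.stalkSpecializes ((genericPoint_spec X).specializes trivial) ≫ functionFieldMap π =
      π.stalkMap y ≫ Y.presheaf.stalkSpecializes ((genericPoint_spec Y).specializes trivial) := by
  rw [functionFieldMap, ← Category.assoc, TopCat.Presheaf.stalkSpecializes_comp]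
  exact Scheme.Hom.stalkSpecializes_stalkMap π _ _ _

theorem functionFieldMap_algebraMap [IsDominant π] (y : Y) (a : X.presheaf.stalk (π y)) :
    (functionFieldMap π).hom (algebraMap (X.presheaf.stalk (π y)) X.functionField a) =
      algebraMap (Y.presheaf.stalk y) Y.functionField ((π.stalkMap y).hom a) :=
  DFunLike.congr_fun (CommRingCat.hom_ext_iff.mp (stalkSpecializes_functionFieldMap π y)) a

theorem functionFieldMap_injective [IsDominant π] :
    Function.Injective (functionFieldMap π).hom :=
  (functionFieldMap π).hom.injective

theorem functionFieldMap_surjective [h : IsBirational π] :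
    Function.Surjective (functionFieldMap π).hom := by
  obtain ⟨f, hf⟩ := h.birationalOver
  have h2 : f.iso.hom ≫ f.target.ι = f.source.ι ≫ π := by
    simpa [Scheme.PartialIso.IsOver] using hf
  have h3 : IsOpenImmersion (f.source.ι ≫ π) := h2 ▸ inferInstance
  have hmem : genericPoint Y ∈ f.source :=
    ((genericPoint_spec Y).mem_open_set_iff f.source.isOpen).mpr
      (by simpa using f.dense_source.nonempty)
  let z : f.source.toScheme := ⟨genericPoint Y, hmem⟩
  have h4 : IsIso ((f.source.ι ≫ π).stalkMap z) := inferInstance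
  rw [Scheme.Hom.stalkMap_comp] at h4
  have h5 : IsIso (π.stalkMap (f.source.ι z)) :=
    @IsIso.of_isIso_comp_right _ _ _ _ _ _ (f.source.ι.stalkMap z) inferInstance h4
  have h6 : IsIso (π.stalkMap (genericPoint Y)) := h5
  have h7 : IsIso (X.presheaf.stalkSpecializes (specializes_of_eq (map_genericPoint π))) :=
    inferInstanceAs (IsIso (X.presheaf.stalkCongr (.of_eq (map_genericPoint π))).inv)
  have h8 : IsIso (functionFieldMap π) := by
    rw [functionFieldMap]; infer_instance
  exact ((ConcreteCategory.isIso_iff_bijective (functionFieldMap π)).mp h8).2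

variable [IsLocallyNoetherian Y] [IsLocallyNoetherian X] [IsNormalScheme Y] [IsNormalScheme X]

omit [IsLocallyNoetherian X] [IsNormalScheme X] in
theorem ord_functionFieldMap_nonneg [IsDominant π] {y : Y} (hy : coheight y = 1)
    {a : X.presheaf.stalk (π y)} (ha : a ≠ 0) :
    0 ≤ Scheme.ord ((functionFieldMap π).hom
      (algebraMap (X.presheaf.stalk (π y)) X.functionField a)) y := by
  rw [ord_nonneg_iff hy, functionFieldMap_algebraMap]
  · exact ⟨_, rfl⟩
  · rw [map_ne_zero_iff _ (functionFieldMap_injective π),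
      map_ne_zero_iff _ (IsFractionRing.injective _ _)]
    exact ha

/-- A birational morphism preserves orders at points of codimension one over points of codimension
one: the order at `y` is a multiple of the order at `π y`, and takes the value one. -/
theorem ord_functionFieldMap [IsBirational π] {y : Y} (hy : coheight y = 1)
    (hx : coheight (π y) = 1) {f : X.functionField} (hf : f ≠ 0) :
    Scheme.ord ((functionFieldMap π).hom f) y = Scheme.ord f (π y) := by
  have hinj := functionFieldMap_injective π
  have hne : ∀ {f : X.functionField}, f ≠ 0 → (functionFieldMap π).hom f ≠ 0 := fun hf => by
    rwa [map_ne_zero_iff _ hinj]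
  have hnn : ∀ {f : X.functionField}, f ≠ 0 → 0 ≤ Scheme.ord f (π y) →
      0 ≤ Scheme.ord ((functionFieldMap π).hom f) y := by
    intro f hf h
    obtain ⟨a, rfl⟩ := (ord_nonneg_iff hx hf).mp h
    exact ord_functionFieldMap_nonneg π hy (by rintro rfl; exact hf (map_zero _))
  have hz : ∀ {f : X.functionField}, f ≠ 0 → Scheme.ord f (π y) = 0 →
      Scheme.ord ((functionFieldMap π).hom f) y = 0 := by
    intro f hf h
    have h1 := hnn hf h.ge
    have h2 := hnn (inv_ne_zero hf) (by rw [ord_inv hf]; omega)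
    rw [map_inv₀, ord_inv (hne hf)] at h2
    omega
  obtain ⟨t, ht0, ht⟩ := exists_ord_eq_one hx
  set τ := algebraMap (X.presheaf.stalk (π y)) X.functionField t with hτ
  have hτ0 : τ ≠ 0 := by
    rwa [hτ, map_ne_zero_iff _ (IsFractionRing.injective _ _)]
  have key : ∀ {f : X.functionField}, f ≠ 0 → Scheme.ord ((functionFieldMap π).hom f) y =
      Scheme.ord f (π y) * Scheme.ord ((functionFieldMap π).hom τ) y := by
    intro f hf
    have h1 := hz (f := f * τ ^ (-Scheme.ord f (π y))) (mul_ne_zero hf (zpow_ne_zero _ hτ0)) (by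
      rw [Scheme.ord_mul hf (zpow_ne_zero _ hτ0), ord_zpow hτ0, ht]; ring)
    rw [map_mul, map_zpow₀, Scheme.ord_mul (hne hf) (zpow_ne_zero _ (hne hτ0)),
      ord_zpow (hne hτ0)] at h1
    linarith
  obtain ⟨s, hs0, hs⟩ := exists_ord_eq_one hy
  obtain ⟨σ, hσ⟩ := functionFieldMap_surjective π
    (algebraMap (Y.presheaf.stalk y) Y.functionField s)
  have hσ0 : σ ≠ 0 := by
    rintro rfl
    rw [map_zero, eq_comm, map_eq_zero_iff _ (IsFractionRing.injective _ _)] at hσ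
    exact hs0 hσ
  have h1 := key hσ0
  rw [hσ, hs] at h1
  have h2 := hnn hτ0 (by rw [ht]; exact zero_le_one)
  have h3 : Scheme.ord ((functionFieldMap π).hom τ) y = 1 :=
    Int.eq_one_of_dvd_one h2 ⟨_, by rw [h1, mul_comm]⟩
  rw [key hf, h3, mul_one]

end FunctionField

/-! ### Points of codimension one under a proper birational morphism -/

section Valuative

variable {Y X : Scheme.{u}} [IsIntegral Y] [IsIntegral X] (π : Y ⟶ X)

/-- The homomorphism from the local ring at `x` to the function field of `Y`. -/
noncomputable def stalkToFunctionField [IsDominant π] (x : X) :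
    X.presheaf.stalk x ⟶ Y.functionField :=
  X.presheaf.stalkSpecializes ((genericPoint_spec X).specializes trivial) ≫ functionFieldMap π

theorem fromSpecStalk_genericPoint_comp [IsDominant π] (x : X) :
    Y.fromSpecStalk (genericPoint Y) ≫ π =
      Spec.map (stalkToFunctionField π x) ≫ X.fromSpecStalk x := by
  rw [stalkToFunctionField, functionFieldMap, Spec.map_comp, Spec.map_comp, Category.assoc,
    Category.assoc, Scheme.SpecMap_stalkSpecializes_fromSpecStalk,
    Scheme.SpecMap_stalkSpecializes_fromSpecStalk, Scheme.SpecMap_stalkMap_fromSpecStalk]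

variable [IsLocallyNoetherian X] [IsNormalScheme X]

omit [IsIntegral Y] [IsIntegral X] [IsLocallyNoetherian X] [IsNormalScheme X] in
theorem existsUnique_lift_of_valuationRing [IsProper π] {O K : CommRingCat.{u}} [IsDomain O]
    [ValuationRing O] (hK : IsField K) (j : O ⟶ K)
    (hj : letI := j.hom.toAlgebra; IsFractionRing O K)
    (i₁ : Spec K ⟶ Y) (i₂ : Spec O ⟶ X) (h : i₁ ≫ π = Spec.map j ≫ i₂) :
    ∃! l : Spec O ⟶ Y, Spec.map j ≫ l = i₁ ∧ l ≫ π = i₂ := by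
  have hV : ValuativeCriterion π := by
    have h : @IsProper _ _ π := ‹_›
    rw [IsProper.eq_valuativeCriterion] at h
    exact h.1.1.1
  let := hK.toField
  let := j.hom.toAlgebra
  obtain ⟨⟨⟨l⟩, hl⟩⟩ := hV { R := O, K := K, i₁ := i₁, i₂ := i₂, commSq := ⟨h⟩ }
  refine ⟨l.l, ⟨l.fac_left, l.fac_right⟩, ?_⟩
  rintro l' ⟨h1, h2⟩
  exact congrArg CommSq.LiftStruct.l (hl ⟨l', h1, h2⟩)

/-- The valuative criterion for the local ring at a point of codimension one. -/
theorem existsUnique_lift [IsBirational π] [IsProper π] {x : X} (hx : coheight x = 1) :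
    ∃! l : Spec (X.presheaf.stalk x) ⟶ Y,
      Spec.map (stalkToFunctionField π x) ≫ l = Y.fromSpecStalk (genericPoint Y) ∧
        l ≫ π = X.fromSpecStalk x := by
  have := isDiscreteValuationRing_stalk X hx
  let : Algebra (X.presheaf.stalk x) Y.functionField := (stalkToFunctionField π x).hom.toAlgebra
  let ε : X.functionField ≃+* Y.functionField := RingEquiv.ofBijective (functionFieldMap π).hom
    ⟨functionFieldMap_injective π, functionFieldMap_surjective π⟩
  let ε' : X.functionField ≃ₐ[X.presheaf.stalk x] Y.functionField :=
    AlgEquiv.ofRingEquiv (f := ε) fun _ => rfl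
  have : IsFractionRing (X.presheaf.stalk x) Y.functionField :=
    IsLocalization.isLocalization_of_algEquiv _ ε'
  exact existsUnique_lift_of_valuationRing π (Field.toIsField Y.functionField)
    (stalkToFunctionField π x) this _ _ (fromSpecStalk_genericPoint_comp π x)

/-- The image of the closed point under the lift in the valuative criterion is a point with the
same local ring as `x`. -/
theorem exists_coheight_eq_one [IsBirational π] [IsProper π] {x : X} (hx : coheight x = 1) :
    ∃ y : Y, π y = x ∧ coheight y = 1 := by
  obtain ⟨l, ⟨h1, h2⟩, -⟩ := existsUnique_lift π hx
  obtain ⟨y, rfl, α, hα⟩ : ∃ y : Y, π y = x ∧ ∃ α : Y.presheaf.stalk y ⟶ X.presheaf.stalk x,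
      α ≫ stalkToFunctionField π x =
        Y.presheaf.stalkSpecializes ((genericPoint_spec Y).specializes trivial) := by
    refine ⟨l (IsLocalRing.closedPoint (X.presheaf.stalk x)), ?_, Scheme.stalkClosedPointTo l, ?_⟩
    · have := congrArg (fun f : Spec (X.presheaf.stalk x) ⟶ X =>
        f (IsLocalRing.closedPoint (X.presheaf.stalk x))) h2
      exact this.trans Scheme.fromSpecStalk_closedPoint
    · apply Spec.map_injective
      rw [← cancel_mono (Y.fromSpecStalk _), Spec.map_comp, Category.assoc,
        Scheme.Spec_stalkClosedPointTo_fromSpecStalk, h1,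
        Scheme.SpecMap_stalkSpecializes_fromSpecStalk]
  refine ⟨y, rfl, ?_⟩
  have hY : Function.Injective (algebraMap (Y.presheaf.stalk y) Y.functionField) :=
    IsFractionRing.injective _ _
  have hX : Function.Injective (algebraMap (X.presheaf.stalk (π y)) X.functionField) :=
    IsFractionRing.injective _ _
  have hb : Function.Bijective (π.stalkMap y).hom := by
    constructor
    · intro a b hab
      apply hX
      apply functionFieldMap_injective π
      rw [functionFieldMap_algebraMap, functionFieldMap_algebraMap, hab]
    · intro a
      refine ⟨α.hom a, hY ?_⟩
      rw [← functionFieldMap_algebraMap]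
      exact DFunLike.congr_fun (CommRingCat.hom_ext_iff.mp hα) a
  have hd := ringKrullDim_eq_of_ringEquiv (RingEquiv.ofBijective _ hb)
  rw [ringKrullDim_stalk_eq_coheight, ringKrullDim_stalk_eq_coheight, hx] at hd
  exact_mod_cast hd.symm

variable [IsLocallyNoetherian Y] [IsNormalScheme Y]

/-- If `y` has codimension one and lies over `x`, then `𝒪_{X,x} = 𝒪_{Y,y}`, so the lift in the
valuative criterion sends the closed point to `y`. -/
theorem exists_lift_closedPoint_eq [IsBirational π] {x : X} (hx : coheight x = 1) {y : Y}
    (hy : coheight y = 1) (hyx : π y = x) : ∃ l : Spec (X.presheaf.stalk x) ⟶ Y,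
      (Spec.map (stalkToFunctionField π x) ≫ l = Y.fromSpecStalk (genericPoint Y) ∧
        l ≫ π = X.fromSpecStalk x) ∧ l (IsLocalRing.closedPoint (X.presheaf.stalk x)) = y := by
  subst hyx
  have hY : Function.Injective (algebraMap (Y.presheaf.stalk y) Y.functionField) :=
    IsFractionRing.injective _ _
  have hX : Function.Injective (algebraMap (X.presheaf.stalk (π y)) X.functionField) :=
    IsFractionRing.injective _ _
  have hb : Function.Bijective (π.stalkMap y) := by
    constructor
    · intro a b hab
      apply hX
      apply functionFieldMap_injective π
      rw [functionFieldMap_algebraMap, functionFieldMap_algebraMap]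
      exact congrArg _ hab
    · intro a
      by_cases ha : a = 0
      · exact ⟨0, by rw [map_zero, ha]⟩
      obtain ⟨f, hf⟩ := functionFieldMap_surjective π
        (algebraMap (Y.presheaf.stalk y) Y.functionField a)
      have hf0 : f ≠ 0 := by
        rintro rfl
        rw [map_zero, eq_comm, map_eq_zero_iff _ hY] at hf
        exact ha hf
      have h1 := ord_algebraMap_nonneg hy ha
      rw [← hf, ord_functionFieldMap π hy hx hf0, ord_nonneg_iff hx hf0] at h1
      obtain ⟨b, rfl⟩ := h1
      refine ⟨b, hY ?_⟩
      rw [← hf, functionFieldMap_algebraMap]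
  have : IsIso (π.stalkMap y) := (ConcreteCategory.isIso_iff_bijective _).mpr hb
  refine ⟨Spec.map (inv (π.stalkMap y)) ≫ Y.fromSpecStalk y, ⟨?_, ?_⟩, ?_⟩
  · rw [stalkToFunctionField, stalkSpecializes_functionFieldMap, ← Spec.map_comp_assoc,
      IsIso.inv_hom_id_assoc, Scheme.SpecMap_stalkSpecializes_fromSpecStalk]
  · rw [Category.assoc, ← Scheme.SpecMap_stalkMap_fromSpecStalk, ← Spec.map_comp_assoc,
      IsIso.hom_inv_id, Spec.map_id, Category.id_comp]
  · have h1 : IsLocalHom (inv (π.stalkMap y)).hom := isLocalHom_of_isIso _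
    have h2 : Spec.map (inv (π.stalkMap y)) (IsLocalRing.closedPoint (X.presheaf.stalk (π y))) =
        IsLocalRing.closedPoint (Y.presheaf.stalk y) :=
      IsLocalRing.comap_closedPoint (inv (π.stalkMap y)).hom
    exact (congrArg (Y.fromSpecStalk y) h2).trans Scheme.fromSpecStalk_closedPoint

theorem eq_of_coheight_eq_one [IsBirational π] [IsProper π] {y y' : Y} (hy : coheight y = 1)
    (hy' : coheight y' = 1) (hx : coheight (π y) = 1) (h : π y' = π y) : y' = y := by
  obtain ⟨l, hl, hly⟩ := exists_lift_closedPoint_eq π hx hy rfl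
  obtain ⟨l', hl', hly'⟩ := exists_lift_closedPoint_eq π hx hy' h
  rw [← hly, ← hly', (existsUnique_lift π hx).unique hl' hl]

theorem pushforwardDivisor_apply [IsBirational π] [IsProper π] (D : WeilDivisor Y ℤ)
    (y : PrimeDivisor Y) (hx : coheight (π y.1) = 1) :
    pushforwardDivisor π D ⟨π y.1, hx⟩ = D y := by
  have h : ∀ z : {z : PrimeDivisor Y // π z.1 = π y.1}, z ≠ ⟨y, rfl⟩ → D z.1 = 0 := by
    intro z hz
    exact absurd (Subtype.ext (Subtype.ext (eq_of_coheight_eq_one π y.2 z.1.2 hx z.2))) hz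
  exact finsum_eq_single _ _ h

end Valuative

/-! ### Rational functions on an affine normal scheme -/

section Affine

variable {R : Type u} [CommRing R]

/-- The homomorphism from `R` to the function field of an integral scheme over `Spec R`. -/
noncomputable def toFunctionField {Y : Scheme.{u}} [IsIntegral Y]
    (π : Y ⟶ Spec (CommRingCat.of R)) : R →+* Y.functionField :=
  (algebraMap Γ(Y, ⊤) Y.functionField).comp (toGlobal π)

theorem toGlobal_id (r : R) : toGlobal (𝟙 (Spec (CommRingCat.of R))) r =
    (Scheme.ΓSpecIso (CommRingCat.of R)).inv.hom r := by
  simp [toGlobal]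

variable [IsDomain R]

theorem functionFieldMap_toFunctionField {Y : Scheme.{u}} [IsIntegral Y]
    (π : Y ⟶ Spec (CommRingCat.of R)) [IsDominant π] (r : R) :
    (functionFieldMap π).hom (toFunctionField (𝟙 (Spec (CommRingCat.of R))) r) =
      toFunctionField π r := by
  have h : (Spec (CommRingCat.of R)).germToFunctionField ⊤ ≫ functionFieldMap π =
      π.appTop ≫ Y.germToFunctionField ⊤ := by
    rw [functionFieldMap, Scheme.germToFunctionField, TopCat.Presheaf.germ_stalkSpecializes_assoc]
    exact Scheme.Hom.germ_stalkMap π ⊤ _ _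
  have h1 := DFunLike.congr_fun (CommRingCat.hom_ext_iff.mp h)
    ((Scheme.ΓSpecIso (CommRingCat.of R)).inv.hom r)
  change (functionFieldMap π).hom (algebraMap _ _ (toGlobal (𝟙 _) r)) = _
  rw [toGlobal_id]
  exact h1

/-- The prime ideal of a point of `Spec R`. -/
def primeIdeal (x : Spec (CommRingCat.of R)) : Ideal R :=
  PrimeSpectrum.asIdeal (R := R) x

instance isPrime_primeIdeal (x : Spec (CommRingCat.of R)) : (primeIdeal x).IsPrime :=
  PrimeSpectrum.isPrime (R := R) x

omit [IsDomain R] in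
theorem isLocalization_stalk (x : Spec (CommRingCat.of R)) :
    letI : Algebra R ((Spec (CommRingCat.of R)).presheaf.stalk x) := StructureSheaf.stalkAlgebra R x
    IsLocalization.AtPrime ((Spec (CommRingCat.of R)).presheaf.stalk x) (primeIdeal x) :=
  StructureSheaf.IsLocalization.to_stalk R x

theorem toFunctionField_id_eq_algebraMap_stalk (x : Spec (CommRingCat.of R)) (r : R) :
    letI : Algebra R ((Spec (CommRingCat.of R)).presheaf.stalk x) := StructureSheaf.stalkAlgebra R x
    toFunctionField (𝟙 (Spec (CommRingCat.of R))) r =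
      algebraMap ((Spec (CommRingCat.of R)).presheaf.stalk x)
        (Spec (CommRingCat.of R)).functionField
        (algebraMap R ((Spec (CommRingCat.of R)).presheaf.stalk x) r) := by
  change algebraMap _ _ (toGlobal (𝟙 _) r) = _
  rw [toGlobal_id]
  exact (Scheme.algebraMap_germ_eq_germToFunctionField (X := Spec (CommRingCat.of R)) (U := ⊤)
    (x := x) trivial ((Scheme.ΓSpecIso (CommRingCat.of R)).inv.hom r)).symm

theorem isFractionRing_toFunctionField_id :
    letI := (toFunctionField (𝟙 (Spec (CommRingCat.of R)))).toAlgebra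
    IsFractionRing R (Spec (CommRingCat.of R)).functionField := by
  have h := functionField_isFractionRing_of_affine (CommRingCat.of R)
  convert! h using 1

theorem mem_range_stalk_iff (x : Spec (CommRingCat.of R)) (f : (Spec (CommRingCat.of R)).functionField) :
    f ∈ (algebraMap ((Spec (CommRingCat.of R)).presheaf.stalk x)
      (Spec (CommRingCat.of R)).functionField).range ↔ ∃ s ∉ primeIdeal x, ∃ a,
        toFunctionField (𝟙 (Spec (CommRingCat.of R))) s * f =
          toFunctionField (𝟙 (Spec (CommRingCat.of R))) a := by
  let : Algebra R ((Spec (CommRingCat.of R)).presheaf.stalk x) := StructureSheaf.stalkAlgebra R x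
  have := isLocalization_stalk x
  simp only [toFunctionField_id_eq_algebraMap_stalk x]
  constructor
  · rintro ⟨z, rfl⟩
    obtain ⟨⟨a, s⟩, h⟩ := IsLocalization.surj (primeIdeal x).primeCompl z
    refine ⟨s, s.2, a, ?_⟩
    rw [← map_mul, mul_comm, h]
  · rintro ⟨s, hs, a, h⟩
    obtain ⟨v, hv⟩ := IsLocalization.map_units ((Spec (CommRingCat.of R)).presheaf.stalk x)
      (⟨s, hs⟩ : (primeIdeal x).primeCompl)
    refine ⟨algebraMap R _ a * (v⁻¹ : _ˣ), ?_⟩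
    rw [map_mul, ← h, ← hv, mul_right_comm, ← map_mul, Units.mul_inv, map_one, one_mul]

omit [IsDomain R] in
theorem coheight_eq_height (x : Spec (CommRingCat.of R)) :
    ((coheight x : ℕ∞) : WithBot ℕ∞) = (primeIdeal x).height := by
  let : Algebra R ((Spec (CommRingCat.of R)).presheaf.stalk x) := StructureSheaf.stalkAlgebra R x
  have := isLocalization_stalk x
  rw [← ringKrullDim_stalk_eq_coheight,
    IsLocalization.AtPrime.ringKrullDim_eq_height (primeIdeal x) ((Spec (CommRingCat.of R)).presheaf.stalk x)]

variable [IsNoetherianRing R] [IsIntegrallyClosed R]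

/-- A rational function without poles in codimension one is regular. -/
theorem mem_range_toFunctionField_id (f : (Spec (CommRingCat.of R)).functionField)
    (hf : f ≠ 0 → ∀ x : PrimeDivisor (Spec (CommRingCat.of R)), 0 ≤ Scheme.ord f x.1) :
    f ∈ (toFunctionField (𝟙 (Spec (CommRingCat.of R)))).range := by
  by_cases hf0 : f = 0
  · rw [hf0]; exact zero_mem _
  let := (toFunctionField (𝟙 (Spec (CommRingCat.of R)))).toAlgebra
  have : IsFractionRing R (Spec (CommRingCat.of R)).functionField :=
    isFractionRing_toFunctionField_id
  refine mem_range_of_forall_height_one f fun P hP hP1 => ?_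
  let x : Spec (CommRingCat.of R) := (⟨P, hP⟩ : PrimeSpectrum R)
  have hx : coheight x = 1 := by
    have : _ = (P.height : WithBot ℕ∞) := coheight_eq_height x
    rw [hP1] at this
    exact_mod_cast this
  exact (mem_range_stalk_iff x f).mp ((ord_nonneg_iff hx hf0).mp (hf hf0 ⟨x, hx⟩))

/-- A rational function without poles at the points of codimension one that specialize to `x` is
regular at `x`. -/
theorem mem_range_stalk (x : Spec (CommRingCat.of R))
    (f : (Spec (CommRingCat.of R)).functionField) (hf0 : f ≠ 0)
    (hf : ∀ z : PrimeDivisor (Spec (CommRingCat.of R)), z.1 ⤳ x → 0 ≤ Scheme.ord f z.1) :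
    f ∈ (algebraMap ((Spec (CommRingCat.of R)).presheaf.stalk x)
      (Spec (CommRingCat.of R)).functionField).range := by
  let : Algebra R ((Spec (CommRingCat.of R)).presheaf.stalk x) := StructureSheaf.stalkAlgebra R x
  have := isLocalization_stalk x
  have := IsNormalScheme.stalk x
  refine mem_range_of_forall_height_one f fun Q hQ hQ1 => ?_
  have hP : (Q.comap (algebraMap R ((Spec (CommRingCat.of R)).presheaf.stalk x))).IsPrime :=
    Ideal.IsPrime.comap _
  let z : Spec (CommRingCat.of R) := (⟨_, hP⟩ : PrimeSpectrum R)
  have hz : coheight z = 1 := by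
    have h1 := coheight_eq_height z
    have h2 := IsLocalization.height_under (primeIdeal x).primeCompl Q
    rw [show primeIdeal z = Q.under R from rfl, h2, hQ1] at h1
    exact_mod_cast h1
  have hzx : z ⤳ x := by
    refine (PrimeSpectrum.le_iff_specializes (R := R) z x).mp fun r hr => ?_
    by_contra hrx
    exact Set.disjoint_left.mp (IsLocalization.disjoint_under_iff (primeIdeal x).primeCompl
      ((Spec (CommRingCat.of R)).presheaf.stalk x) Q |>.mpr hQ.ne_top) hrx hr
  obtain ⟨s, hs, a, h⟩ := (mem_range_stalk_iff z f).mp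
    ((ord_nonneg_iff hz hf0).mp (hf ⟨z, hz⟩ hzx))
  refine ⟨algebraMap R _ s, hs, algebraMap R _ a, ?_⟩
  rw [← toFunctionField_id_eq_algebraMap_stalk x, ← toFunctionField_id_eq_algebraMap_stalk x]
  exact h

end Affine

/-! ### Orders of regular functions on an affine normal scheme -/

section Affine

variable {R : Type u} [CommRing R] [IsDomain R] [IsNoetherianRing R] [IsIntegrallyClosed R]

omit [IsNoetherianRing R] [IsIntegrallyClosed R] in
theorem toFunctionField_injective {Y : Scheme.{u}} [IsIntegral Y]
    (π : Y ⟶ Spec (CommRingCat.of R)) [IsDominant π] :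
    Function.Injective (toFunctionField π) := by
  intro a b h
  rw [← functionFieldMap_toFunctionField π, ← functionFieldMap_toFunctionField π] at h
  let := (toFunctionField (𝟙 (Spec (CommRingCat.of R)))).toAlgebra
  have : IsFractionRing R (Spec (CommRingCat.of R)).functionField :=
    isFractionRing_toFunctionField_id
  exact IsFractionRing.injective R _ (functionFieldMap_injective π h)

omit [IsNoetherianRing R] [IsIntegrallyClosed R] in
theorem toFunctionField_id_ne_zero {r : R} (hr : r ≠ 0) :
    toFunctionField (𝟙 (Spec (CommRingCat.of R))) r ≠ 0 :=
  (map_ne_zero_iff _ (toFunctionField_injective _)).mpr hr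

omit [IsNoetherianRing R] [IsIntegrallyClosed R] in
theorem ord_toFunctionField_nonneg {Y : Scheme.{u}} [IsIntegral Y] [IsLocallyNoetherian Y]
    (π : Y ⟶ Spec (CommRingCat.of R)) [IsDominant π] {y : Y} (hy : coheight y = 1) {r : R}
    (hr : r ≠ 0) : 0 ≤ Scheme.ord (toFunctionField π r) y := by
  let : Algebra R ((Spec (CommRingCat.of R)).presheaf.stalk (π y)) :=
    StructureSheaf.stalkAlgebra R (π y)
  rw [← functionFieldMap_toFunctionField, toFunctionField_id_eq_algebraMap_stalk (π y),
    functionFieldMap_algebraMap]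
  refine ord_algebraMap_nonneg hy fun h => ?_
  have h1 := functionFieldMap_algebraMap π y (algebraMap R _ r)
  rw [h, map_zero, map_eq_zero_iff _ (functionFieldMap_injective π),
    ← toFunctionField_id_eq_algebraMap_stalk] at h1
  exact toFunctionField_id_ne_zero hr h1

theorem ord_toFunctionField_id_eq_zero_iff {x : Spec (CommRingCat.of R)} (hx : coheight x = 1)
    {r : R} (hr : r ≠ 0) :
    Scheme.ord (toFunctionField (𝟙 (Spec (CommRingCat.of R))) r) x = 0 ↔ r ∉ primeIdeal x := by
  let : Algebra R ((Spec (CommRingCat.of R)).presheaf.stalk x) := StructureSheaf.stalkAlgebra R x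
  have := isLocalization_stalk x
  rw [toFunctionField_id_eq_algebraMap_stalk x, ord_algebraMap_eq_zero_iff hx]
  · exact IsLocalization.AtPrime.isUnit_to_map_iff _ (primeIdeal x) r
  · intro h
    have h1 := toFunctionField_id_eq_algebraMap_stalk x r
    rw [h, map_zero] at h1
    exact toFunctionField_id_ne_zero hr h1

omit [IsDomain R] [IsNoetherianRing R] [IsIntegrallyClosed R] in
/-- There are no inclusions between the prime ideals of different points of codimension one. -/
theorem exists_mem_primeIdeal_notMem {x z : Spec (CommRingCat.of R)} (hx : coheight x = 1)
    (hz : coheight z = 1) (hne : z ≠ x) : ∃ c ∈ primeIdeal x, c ∉ primeIdeal z := by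
  by_contra! h
  have h1 : primeIdeal x ≤ primeIdeal z := h
  have hx' := coheight_eq_height x
  have hz' := coheight_eq_height z
  rw [hx] at hx'
  rw [hz] at hz'
  have hlt : primeIdeal x < primeIdeal z := lt_of_le_of_ne h1 fun h2 =>
    hne (PrimeSpectrum.ext (R := R) h2.symm)
  have hx2 : (primeIdeal x).height = 1 := by exact_mod_cast hx'.symm
  have hz2 : (primeIdeal z).height = 1 := by exact_mod_cast hz'.symm
  have := Ideal.height_add_one_le_of_lt_of_isPrime hlt
  rw [hx2, hz2] at this
  exact absurd this (by decide)

open Classical in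
/-- Sections of `𝒪_X(D)` near a prime divisor, for effective `D`, become global after
multiplication by a function that does not vanish along the divisor. -/
theorem exists_mul_mem_globalSections (D : PrimeDivisor (Spec (CommRingCat.of R)) → ℤ)
    (hD : ∀ z, 0 ≤ D z) (x : PrimeDivisor (Spec (CommRingCat.of R)))
    {v : (Spec (CommRingCat.of R)).functionField} (hv0 : v ≠ 0)
    (hv : -D x ≤ Scheme.ord v x.1) :
    ∃ t ∉ primeIdeal x.1, toFunctionField (𝟙 (Spec (CommRingCat.of R))) t * v ∈
      globalSections (Spec (CommRingCat.of R)) D := by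
  set ι := toFunctionField (𝟙 (Spec (CommRingCat.of R))) with hι
  let : Algebra R ((Spec (CommRingCat.of R)).presheaf.stalk x.1) :=
    StructureSheaf.stalkAlgebra R x.1
  let A := (algebraMap ((Spec (CommRingCat.of R)).presheaf.stalk x.1)
    (Spec (CommRingCat.of R)).functionField).range
  -- the conductor of `v` into the local ring at `x`
  let J : Ideal R :=
    { carrier := {g | ι g * v ∈ A}
      zero_mem' := by
        change ι 0 * v ∈ A
        rw [map_zero, zero_mul]; exact zero_mem _
      add_mem' := fun {a b} ha hb => by
        change ι (a + b) * v ∈ A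
        rw [map_add, add_mul]; exact add_mem ha hb
      smul_mem' := fun c a ha => by
        change ι (c * a) * v ∈ A
        rw [map_mul, mul_assoc]
        exact mul_mem ⟨_, (toFunctionField_id_eq_algebraMap_stalk x.1 c).symm⟩ ha }
  have hloc : ∀ g : R, ∃ t ∉ primeIdeal x.1, g ∈ J → ι t * (ι g * v) ∈ ι.range := by
    intro g
    by_cases hg : g ∈ J
    · obtain ⟨s, hs, a, h⟩ := (mem_range_stalk_iff x.1 _).mp hg
      exact ⟨s, hs, fun _ => ⟨a, h.symm⟩⟩
    · exact ⟨1, fun h => (isPrime_primeIdeal x.1).ne_top ((Ideal.eq_top_iff_one _).mpr h),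
        fun h => absurd h hg⟩
  choose t ht hgt using hloc
  obtain ⟨S, hS⟩ := IsNoetherian.noetherian J
  have hT : ∏ g ∈ S, t g ∉ primeIdeal x.1 := by
    rw [(isPrime_primeIdeal x.1).prod_mem_iff]
    rintro ⟨g, -, h⟩
    exact ht g h
  have hJ : ∀ g ∈ J, ι (∏ g ∈ S, t g) * (ι g * v) ∈ ι.range := by
    intro g hg
    rw [← hS] at hg
    induction hg using Submodule.span_induction with
    | mem g hg =>
      rw [← Finset.mul_prod_erase S t hg, map_mul, mul_comm (ι (t g)), mul_assoc]
      exact mul_mem ⟨_, rfl⟩ (hgt g (hS ▸ Submodule.subset_span hg))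
    | zero => rw [map_zero, zero_mul, mul_zero]; exact zero_mem _
    | add a b _ _ ha hb => rw [map_add, add_mul, mul_add]; exact add_mem ha hb
    | smul c a _ ha =>
      rw [smul_eq_mul, map_mul, mul_assoc, mul_left_comm]
      exact mul_mem ⟨_, rfl⟩ ha
  have hT0 : ∏ g ∈ S, t g ≠ 0 := fun h => hT (h ▸ zero_mem _)
  refine ⟨∏ g ∈ S, t g, hT, fun hne z => ?_⟩
  by_cases hzx : z = x
  · subst hzx
    rw [Scheme.ord_mul (toFunctionField_id_ne_zero hT0) hv0,
      (ord_toFunctionField_id_eq_zero_iff z.2 hT0).mpr hT]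
    omega
  obtain ⟨c, hcx, hcz⟩ := exists_mem_primeIdeal_notMem x.2 z.2 fun h => hzx (Subtype.ext h)
  have hc0 : c ≠ 0 := fun h => hcz (h ▸ zero_mem _)
  have hιc := toFunctionField_id_ne_zero hc0
  have hcx1 : 1 ≤ Scheme.ord (ι c) x.1 := by
    have h1 := ord_toFunctionField_nonneg (𝟙 (Spec (CommRingCat.of R))) x.2 hc0
    have h2 := (ord_toFunctionField_id_eq_zero_iff x.2 hc0).not.mpr (not_not.mpr hcx)
    rw [← hι] at h1 h2
    omega
  -- a power of `c` lies in the conductor, and `c` is a unit at `z`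
  have hcJ : c ^ (D x).toNat ∈ J := by
    refine (ord_nonneg_iff x.2 (mul_ne_zero ((map_pow ι c _).symm ▸ pow_ne_zero _ hιc) hv0)).mp ?_
    rw [map_pow, Scheme.ord_mul (pow_ne_zero _ hιc) hv0, ord_pow hιc]
    have := hD x
    have h3 : ((D x).toNat : ℤ) = D x := Int.toNat_of_nonneg this
    rw [h3]
    nlinarith
  obtain ⟨a, ha⟩ := hJ _ hcJ
  have hιT := toFunctionField_id_ne_zero hT0
  rw [← hι] at hιT
  have ha' : ι a = ι c ^ (D x).toNat * (ι (∏ g ∈ S, t g) * v) := by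
    rw [ha, map_pow]; ring
  have ha0 : a ≠ 0 := by
    rintro rfl
    rw [map_zero] at ha'
    exact mul_ne_zero (pow_ne_zero _ hιc) hne ha'.symm
  have h1 := ord_toFunctionField_nonneg (𝟙 (Spec (CommRingCat.of R))) z.2 ha0
  rw [← hι, ha', Scheme.ord_mul (pow_ne_zero _ hιc) hne, ord_pow hιc,
    (ord_toFunctionField_id_eq_zero_iff z.2 hc0).mpr hcz] at h1
  have := hD z
  rw [mul_zero, zero_add] at h1
  omega

end Affine

/-! ### Pullback of `ℚ`-Cartier divisors -/

section Pullback

variable {R : Type u} [CommRing R] [IsDomain R] [IsNoetherianRing R] [IsIntegrallyClosed R]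
  {Y : Scheme.{u}} [IsIntegral Y] [IsLocallyNoetherian Y] [IsNormalScheme Y]
  (π : Y ⟶ Spec (CommRingCat.of R))
  {D : PrimeDivisor (Spec (CommRingCat.of R)) → ℚ}

omit [IsIntegrallyClosed R] [IsNormalScheme Y] in
theorem exists_pullbackQCartier_eq [IsDominant π] (hD : IsQCartier D) (y : PrimeDivisor Y) :
    ∃ (m : ℕ) (f : (Spec (CommRingCat.of R)).functionField), 0 < m ∧
      IsLocalEquation D m (π y.1) f ∧
        pullbackQCartier π D y = (Scheme.ord ((functionFieldMap π).hom f) y.1 : ℚ) / m := by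
  obtain ⟨m, hm, h⟩ := hD
  obtain ⟨f, hf⟩ := h (π y.1)
  have hex : ∃ a : ℕ × (Spec (CommRingCat.of R)).functionField,
      0 < a.1 ∧ IsLocalEquation D a.1 (π y.1) a.2 := ⟨(m, f), hm, hf⟩
  exact ⟨hex.choose.1, hex.choose.2, hex.choose_spec.1, hex.choose_spec.2, dif_pos hex⟩

/-- If `div h ≥ N D`, then `div (π^* h) ≥ N π^* D`. -/
theorem mul_pullbackQCartier_le_ord [IsDominant π] (hD : IsQCartier D)
    {h : (Spec (CommRingCat.of R)).functionField} (hh : h ≠ 0) (N : ℕ)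
    (hN : ∀ x, (N : ℚ) * D x ≤ Scheme.ord h x.1) (y : PrimeDivisor Y) :
    (N : ℚ) * pullbackQCartier π D y ≤ Scheme.ord ((functionFieldMap π).hom h) y.1 := by
  obtain ⟨m, f, hm, ⟨hf, U, hyU, hU⟩, he⟩ := exists_pullbackQCartier_eq π hD y
  have hm' : (0 : ℚ) < m := by exact_mod_cast hm
  have hhm := pow_ne_zero m hh
  have hfN := inv_ne_zero (pow_ne_zero N hf)
  obtain ⟨a, ha⟩ := mem_range_stalk (π y.1) (h ^ m * (f ^ N)⁻¹) (mul_ne_zero hhm hfN) (by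
    intro z hz
    have h1 := hU z (hz.mem_open U.isOpen hyU)
    have h2 := hN z
    rw [Scheme.ord_mul hhm hfN, ord_pow hh, ord_inv (pow_ne_zero _ hf), ord_pow hf]
    have h3 : (N : ℚ) * Scheme.ord f z.1 ≤ m * Scheme.ord h z.1 := by
      rw [h1]; nlinarith
    have h4 : (N : ℤ) * Scheme.ord f z.1 ≤ m * Scheme.ord h z.1 := by exact_mod_cast h3
    linarith)
  have ha0 : a ≠ 0 := by
    rintro rfl
    rw [map_zero] at ha
    exact mul_ne_zero hhm hfN ha.symm
  have h5 := ord_functionFieldMap_nonneg π y.2 ha0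
  have hinj := functionFieldMap_injective π
  have hh' := (map_ne_zero_iff _ hinj).mpr hh
  have hf' := (map_ne_zero_iff _ hinj).mpr hf
  rw [ha, map_mul, map_inv₀, map_pow, map_pow,
    Scheme.ord_mul (pow_ne_zero _ hh') (inv_ne_zero (pow_ne_zero _ hf')),
    ord_pow hh', ord_inv (pow_ne_zero _ hf'), ord_pow hf'] at h5
  have h6 : (N : ℚ) * Scheme.ord ((functionFieldMap π).hom f) y.1 ≤
      m * Scheme.ord ((functionFieldMap π).hom h) y.1 := by
    have : (N : ℤ) * Scheme.ord ((functionFieldMap π).hom f) y.1 ≤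
      m * Scheme.ord ((functionFieldMap π).hom h) y.1 := by linarith
    exact_mod_cast this
  rw [he, ← mul_div_assoc, div_le_iff₀ hm']
  linarith

theorem pullbackQCartier_eq [IsBirational π] (hD : IsQCartier D) (y : PrimeDivisor Y)
    (hx : coheight (π y.1) = 1) : pullbackQCartier π D y = D ⟨π y.1, hx⟩ := by
  obtain ⟨m, f, hm, ⟨hf, U, hyU, hU⟩, he⟩ := exists_pullbackQCartier_eq π hD y
  have hm' : (m : ℚ) ≠ 0 := by exact_mod_cast hm.ne'
  rw [he, ord_functionFieldMap π y.2 hx hf, hU ⟨π y.1, hx⟩ hyU, mul_div_cancel_left₀ _ hm']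

end Pullback

/-! ### Extension of `p⁻ᵉ`-linear maps to the fraction field -/

/-- A `q⁻¹`-linear map on an `R`-submodule that spans the fraction field extends to the fraction
field. The submodule is given by an additive map `i : M →+ L`. -/
theorem exists_extension {R L M : Type*} [CommRing R] [IsDomain R] [Field L] [Algebra R L]
    [IsFractionRing R L] [AddCommGroup M] (i : M →+ L)
    (hi : ∀ (r : R) (m : M), ∃ m', i m' = algebraMap R L r * i m) (q : ℕ)
    (hM : ∀ f : L, ∃ r : R, r ≠ 0 ∧ ∃ m, i m = algebraMap R L r ^ q * f) (φ : M →+ R)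
    (hφ : ∀ (r : R) (m m' : M), i m' = algebraMap R L r ^ q * i m → φ m' = r * φ m) :
    ∃ Φ : L →+ L, (∀ r x, Φ (r ^ q * x) = r * Φ x) ∧ ∀ m, Φ (i m) = algebraMap R L (φ m) := by
  choose d hd0 s hs using hM
  have hj : ∀ {r : R}, r ≠ 0 → algebraMap R L r ≠ 0 := fun h =>
    (map_ne_zero_iff _ (IsFractionRing.injective R L)).mpr h
  have hi' : ∀ (r : R) (m : M), ∃ m', i m' = algebraMap R L r ^ q * i m := fun r m => by
    rw [← map_pow]; exact hi _ m
  -- independence of the denominator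
  have key : ∀ (f : L) (r : R) (m : M), r ≠ 0 → i m = algebraMap R L r ^ q * f →
      algebraMap R L (φ (s f)) / algebraMap R L (d f) = algebraMap R L (φ m) / algebraMap R L r := by
    intro f r m hr hm
    obtain ⟨m', hm'⟩ := hi' r (s f)
    have h1 := hφ r _ _ hm'
    have h2 := hφ (d f) m m' (by rw [hm', hs, hm]; ring)
    rw [div_eq_div_iff (hj (hd0 f)) (hj hr), ← map_mul, ← map_mul, mul_comm _ r, ← h1, h2, mul_comm]
  refine ⟨AddMonoidHom.mk' (fun f => algebraMap R L (φ (s f)) / algebraMap R L (d f)) ?_, ?_, ?_⟩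
  · intro f g
    obtain ⟨m, hm⟩ := hi' (d g) (s f)
    obtain ⟨n, hn⟩ := hi' (d f) (s g)
    rw [hs] at hm hn
    have hfg : d f * d g ≠ 0 := mul_ne_zero (hd0 f) (hd0 g)
    rw [key f (d f * d g) m hfg (by rw [hm, map_mul]; ring),
      key g (d f * d g) n hfg (by rw [hn, map_mul]; ring),
      key (f + g) (d f * d g) (m + n) hfg (by rw [map_add, hm, hn, map_mul]; ring),
      map_add, map_add, add_div]
  · intro x f
    change algebraMap R L _ / _ = x * (algebraMap R L _ / _)
    obtain ⟨a, b, hb, rfl⟩ := IsFractionRing.div_surjective (A := R) x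
    have hb0 := nonZeroDivisors.ne_zero hb
    obtain ⟨m, hm⟩ := hi' a (s f)
    rw [key _ (b * d f) m (mul_ne_zero hb0 (hd0 f)) (by
      have := hj hb0
      rw [hm, hs, map_mul, mul_pow, div_pow]; field_simp), hφ a _ _ hm, map_mul, map_mul, div_mul_div_comm]
  · intro m
    change algebraMap R L _ / _ = _
    rw [key (i m) 1 m one_ne_zero (by simp)]
    simp

/-! ### Orders and duality -/

section Order

variable {p : ℕ} [Fact p.Prime] {k : Type u} [Field k] [PerfectField k] {Y : Scheme.{u}} [IsIntegral Y]
  [IsLocallyNoetherian Y] [IsNormalScheme Y] [Algebra k Y.functionField]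
  [Algebra.EssFiniteType k Y.functionField] [CharP Y.functionField p]
  {C : TopForms k Y.functionField →+ TopForms k Y.functionField}
  {ω η : TopForms k Y.functionField} {g h : Y.functionField}
  {Φ : Y.functionField →+ Y.functionField}

/-- If the map corresponding to `h` sends `𝒪(n)` into the local ring at `y`, then
`ord h ≥ (pᵉ - 1) ord ω + n` at `y`. -/
theorem IsCartierOperator.le_ord (hC : IsCartierOperator p C) (e : ℕ)
    (hΦ : ∀ f, Φ f • ω = C^[e] ((f * h) • ω)) (hω : ω ≠ 0)
    (hh : h ≠ 0) {y : Y} (hy : coheight y = 1)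
    (hη : IsGenerator k Y.functionField (Y.presheaf.stalk y) η) (hg : g ≠ 0) (hωη : ω = g • η)
    {n : ℤ} (hn : ∀ v, v ≠ 0 → -n ≤ Scheme.ord v y → Φ v ≠ 0 → 0 ≤ Scheme.ord (Φ v) y) :
    ((p : ℤ) ^ e - 1) * Scheme.ord g y + n ≤ Scheme.ord h y := by
  have hη0 : η ≠ 0 := by
    rintro rfl
    exact hω (by rw [hωη, smul_zero])
  have hnorm := IsNormalScheme.stalk y
  obtain ⟨t, ht0, ht⟩ := exists_ord_eq_one hy
  set τ := algebraMap (Y.presheaf.stalk y) Y.functionField t with hτ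
  have hτ0 : τ ≠ 0 := by
    rwa [hτ, map_ne_zero_iff _ (IsFractionRing.injective _ _)]
  have hτn : τ ^ (-n) ≠ 0 := zpow_ne_zero _ hτ0
  have hgp : g⁻¹ ^ p ^ e ≠ 0 := pow_ne_zero _ (inv_ne_zero hg)
  -- in terms of `η = g⁻¹ ω`, the map `Φ` on `𝒪(n) = τ⁻ⁿ 𝒪` is `Cᵉ` and multiplication with
  -- `τ⁻ⁿ h g ^ (1 - pᵉ)`
  have hmem : τ ^ (-n) * (h * (g * g⁻¹ ^ p ^ e)) ∈
      (algebraMap (Y.presheaf.stalk y) Y.functionField).range := by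
    refine hC.mem_range_of_forall_iterate hη hη0 e fun x => ?_
    set v := algebraMap (Y.presheaf.stalk y) Y.functionField x * τ ^ (-n) with hv
    have hΦv : Φ v ∈ (algebraMap (Y.presheaf.stalk y) Y.functionField).range := by
      by_cases hx : x = 0
      · rw [hv, hx, map_zero, zero_mul, map_zero]; exact zero_mem _
      by_cases hΦ0 : Φ v = 0
      · rw [hΦ0]; exact zero_mem _
      have hx' : algebraMap (Y.presheaf.stalk y) Y.functionField x ≠ 0 := by
        rwa [map_ne_zero_iff _ (IsFractionRing.injective _ _)]
      refine (ord_nonneg_iff hy hΦ0).mp (hn v (mul_ne_zero hx' hτn) ?_ hΦ0)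
      rw [hv, Scheme.ord_mul hx' hτn, ord_zpow hτ0, ht]
      have := ord_algebraMap_nonneg hy hx
      omega
    obtain ⟨b, hb⟩ := hΦv
    refine ⟨b, ?_⟩
    have h1 : (algebraMap (Y.presheaf.stalk y) Y.functionField x *
        (τ ^ (-n) * (h * (g * g⁻¹ ^ p ^ e)))) • η = g⁻¹ ^ p ^ e • (v * h) • ω := by
      rw [hωη, smul_smul, smul_smul, hv]
      congr 1
      ring
    rw [h1, hC.iterate_pow_smul, ← hΦ, hb, hωη, smul_smul, smul_smul]
    congr 1
    field_simp
  have h3 := mul_ne_zero hg hgp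
  have h2 := mul_ne_zero hh h3
  have h1 := (ord_nonneg_iff hy (mul_ne_zero hτn h2)).mpr hmem
  rw [Scheme.ord_mul hτn h2, Scheme.ord_mul hh h3, Scheme.ord_mul hg hgp,
    ord_pow (inv_ne_zero hg), ord_inv hg, ord_zpow hτ0, ht] at h1
  push_cast at h1
  linarith

/-- If `ord (v h ω) ≥ pᵉ (ord ω - b)` at `y`, then the map corresponding to `h` sends `v` to
`𝒪(b)`. -/
theorem IsCartierOperator.le_ord_apply (hC : IsCartierOperator p C) (e : ℕ)
    (hΦ : ∀ f, Φ f • ω = C^[e] ((f * h) • ω))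
    (hω : ω ≠ 0) (hh : h ≠ 0) {y : Y} (hy : coheight y = 1)
    (hη : IsGenerator k Y.functionField (Y.presheaf.stalk y) η) (hg : g ≠ 0) (hωη : ω = g • η)
    {b : ℤ} {v : Y.functionField} (hv : v ≠ 0) (hΦv : Φ v ≠ 0)
    (hb : (p : ℤ) ^ e * (Scheme.ord g y - b) ≤
      Scheme.ord v y + Scheme.ord h y + Scheme.ord g y) :
    -b ≤ Scheme.ord (Φ v) y := by
  have hη0 : η ≠ 0 := by
    rintro rfl
    exact hω (by rw [hωη, smul_zero])
  have hnorm := IsNormalScheme.stalk y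
  obtain ⟨t, ht0, ht⟩ := exists_ord_eq_one hy
  set τ := algebraMap (Y.presheaf.stalk y) Y.functionField t with hτ
  have hτ0 : τ ≠ 0 := by
    rwa [hτ, map_ne_zero_iff _ (IsFractionRing.injective _ _)]
  have hτb : τ ^ (-b) ≠ 0 := zpow_ne_zero _ hτ0
  have hτg : (τ ^ (-b) * g) ^ p ^ e ≠ 0 := pow_ne_zero _ (mul_ne_zero hτb hg)
  have hvh := mul_ne_zero hv hh
  have hvhg := mul_ne_zero hvh hg
  -- the form `v h ω` is `(τ⁻ᵇ g) ^ pᵉ` times a regular form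
  obtain ⟨x, hx⟩ : v * h * g * ((τ ^ (-b) * g) ^ p ^ e)⁻¹ ∈
      (algebraMap (Y.presheaf.stalk y) Y.functionField).range := by
    refine (ord_nonneg_iff hy (mul_ne_zero hvhg (inv_ne_zero hτg))).mp ?_
    rw [Scheme.ord_mul hvhg (inv_ne_zero hτg), Scheme.ord_mul hvh hg, Scheme.ord_mul hv hh,
      ord_inv hτg, ord_pow (mul_ne_zero hτb hg), Scheme.ord_mul hτb hg, ord_zpow hτ0, ht]
    push_cast
    linarith
  obtain ⟨z, hz⟩ := hC.exists_iterate_smul_eq_algebraMap_smul hη hη0 e x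
  have h1 : (v * h) • ω =
      (τ ^ (-b) * g) ^ p ^ e • algebraMap (Y.presheaf.stalk y) Y.functionField x • η := by
    rw [hx, hωη, smul_smul, smul_smul]
    congr 1
    field_simp
  have h2 : Φ v = τ ^ (-b) * algebraMap (Y.presheaf.stalk y) Y.functionField z := by
    have h3 := hΦ v
    rw [h1, hC.iterate_pow_smul, hz, hωη, smul_smul, smul_smul] at h3
    have h4 := smul_left_injective Y.functionField hη0 h3
    refine mul_right_cancel₀ hg (h4.trans ?_)
    ring
  have hz0 : z ≠ 0 := by
    rintro rfl
    exact hΦv (by rw [h2, map_zero, mul_zero])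
  have hz0' : algebraMap (Y.presheaf.stalk y) Y.functionField z ≠ 0 := by
    rwa [map_ne_zero_iff _ (IsFractionRing.injective _ _)]
  rw [h2, Scheme.ord_mul hτb hz0', ord_zpow hτ0, ht]
  have := ord_algebraMap_nonneg hy hz0
  omega

end Order

/-! ### Function fields of schemes essentially of finite type -/

section EssFiniteType

variable (k S R : Type u) [Field k] [CommRing S] [Algebra k S]
  [CommRing R] [IsDomain R] [Algebra k R] {Y : Scheme.{u}} [IsIntegral Y]
  (π : Y ⟶ Spec (CommRingCat.of R)) [IsBirational π]

variable {R}

theorem isFractionRing_toFunctionField :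
    letI := (toFunctionField π).toAlgebra
    IsFractionRing R Y.functionField := by
  let := (toFunctionField (𝟙 (Spec (CommRingCat.of R)))).toAlgebra
  let := (toFunctionField π).toAlgebra
  have : IsFractionRing R (Spec (CommRingCat.of R)).functionField :=
    isFractionRing_toFunctionField_id
  let ε : (Spec (CommRingCat.of R)).functionField ≃+* Y.functionField :=
    RingEquiv.ofBijective (functionFieldMap π).hom
      ⟨functionFieldMap_injective π, functionFieldMap_surjective π⟩
  let ε' : (Spec (CommRingCat.of R)).functionField ≃ₐ[R] Y.functionField :=
    AlgEquiv.ofRingEquiv (f := ε) fun r => functionFieldMap_toFunctionField π r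
  exact IsLocalization.isLocalization_of_algEquiv _ ε'

omit [IsDomain R] [IsBirational π] in
theorem algebraMap_functionFieldAlgebra (c : k) :
    letI := functionFieldAlgebra (π ≫ Spec.map (CommRingCat.ofHom (algebraMap k R)))
    algebraMap k Y.functionField c = toFunctionField π (algebraMap k R c) := by
  change (Y.germToFunctionField ⊤).hom
      ((π ≫ Spec.map (CommRingCat.ofHom (algebraMap k R))).appTop.hom
        ((Scheme.ΓSpecIso (CommRingCat.of k)).inv.hom c)) =
    (Y.germToFunctionField ⊤).hom
      (π.appTop.hom ((Scheme.ΓSpecIso (CommRingCat.of R)).inv.hom (algebraMap k R c)))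
  have h := DFunLike.congr_fun (CommRingCat.hom_ext_iff.mp
    (Scheme.ΓSpecIso_inv_naturality (CommRingCat.ofHom (algebraMap k R)))) c
  rw [Scheme.Hom.comp_appTop]
  exact congrArg (fun r => (Y.germToFunctionField ⊤).hom (π.appTop.hom r)) h.symm

theorem essFiniteType_functionField [Algebra.EssFiniteType k R] :
    letI := functionFieldAlgebra (π ≫ Spec.map (CommRingCat.ofHom (algebraMap k R)))
    Algebra.EssFiniteType k Y.functionField := by
  let := functionFieldAlgebra (π ≫ Spec.map (CommRingCat.ofHom (algebraMap k R)))
  let := (toFunctionField π).toAlgebra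
  have : IsFractionRing R Y.functionField := isFractionRing_toFunctionField π
  have : IsScalarTower k R Y.functionField :=
    IsScalarTower.of_algebraMap_eq (algebraMap_functionFieldAlgebra k π)
  have : Algebra.EssFiniteType R Y.functionField :=
    Algebra.EssFiniteType.of_isLocalization _ (nonZeroDivisors R)
  exact Algebra.EssFiniteType.comp k R Y.functionField

end EssFiniteType

/-! ### Compatibility of pushforward ideals -/

section Compatible

variable {p : ℕ} [Fact p.Prime] {k : Type u} [Field k] [CharP k p] [PerfectField k]
  {R : Type u} [CommRing R] [IsDomain R] [IsNoetherianRing R] [IsIntegrallyClosed R]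
  [Algebra k R] [Algebra.EssFiniteType k R]
  {Y : Scheme.{u}} [IsIntegral Y] [IsLocallyNoetherian Y] [IsNormalScheme Y]
  (π : Y ⟶ Spec (CommRingCat.of R)) [IsProper π] [IsBirational π]
  {KX : WeilDivisor (Spec (CommRingCat.of R)) ℤ} {KY : WeilDivisor Y ℤ}
  {Δ : WeilDivisor (Spec (CommRingCat.of R)) ℚ}

omit [IsDomain R] [IsNoetherianRing R] [IsIntegrallyClosed R] in
theorem zero_le_ceil (hΔ : 0 ≤ Δ) (e : ℕ)
    (x : PrimeDivisor (Spec (CommRingCat.of R))) : 0 ≤ ⌈((p : ℚ) ^ e - 1) * Δ x⌉ := by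
  have hp : p.Prime := Fact.out
  have h1 : (1 : ℚ) ≤ (p : ℚ) ^ e := one_le_pow₀ (by exact_mod_cast hp.one_le)
  exact Int.ceil_nonneg (mul_nonneg (by linarith) (hΔ x))

theorem toFunctionField_id_mem_globalSections
    {D : PrimeDivisor (Spec (CommRingCat.of R)) → ℤ} (hD : ∀ z, 0 ≤ D z) (r : R) :
    toFunctionField (𝟙 (Spec (CommRingCat.of R))) r ∈
      globalSections (Spec (CommRingCat.of R)) D := by
  intro hr z
  have hr0 : r ≠ 0 := by
    rintro rfl
    exact hr (map_zero _)
  have := ord_toFunctionField_nonneg (𝟙 (Spec (CommRingCat.of R))) z.2 hr0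
  have := hD z
  omega

omit [IsLocallyNoetherian Y] [IsNormalScheme Y] [IsProper π] in
/-- A `p⁻ᵉ`-linear map `φ : R(⌈(pᵉ - 1)Δ⌉) → R` extends to the function field of `Y`. -/
theorem exists_extension_functionField (hΔ : 0 ≤ Δ) (e : ℕ)
    (φ : globalSections (Spec (CommRingCat.of R)) (fun x => ⌈((p : ℚ) ^ e - 1) * Δ x⌉) →+ R)
    (hφ : ∀ (r : R) (m : globalSections (Spec (CommRingCat.of R))
          (fun x => ⌈((p : ℚ) ^ e - 1) * Δ x⌉)),
        φ (toGlobal (𝟙 (Spec (CommRingCat.of R))) (r ^ p ^ e) • m) = r * φ m) :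
    ∃ Φ : Y.functionField →+ Y.functionField, (∀ r x, Φ (r ^ p ^ e * x) = r * Φ x) ∧
      ∀ m, Φ ((functionFieldMap π).hom m.1) = toFunctionField π (φ m) := by
  let := (toFunctionField π).toAlgebra
  have : IsFractionRing R Y.functionField := isFractionRing_toFunctionField π
  have hp : p.Prime := Fact.out
  have hinj := functionFieldMap_injective π
  have hsmul : ∀ (r : R) (m : globalSections (Spec (CommRingCat.of R))
      (fun x => ⌈((p : ℚ) ^ e - 1) * Δ x⌉)),
      (functionFieldMap π).hom (toGlobal (𝟙 (Spec (CommRingCat.of R))) r • m).1 =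
        toFunctionField π r * (functionFieldMap π).hom m.1 := by
    intro r m
    rw [← functionFieldMap_toFunctionField, ← map_mul]
    congr 1
  let i : globalSections (Spec (CommRingCat.of R)) (fun x => ⌈((p : ℚ) ^ e - 1) * Δ x⌉) →+
      Y.functionField :=
    ((functionFieldMap π).hom : _ →+ _).comp (Submodule.subtype _).toAddMonoidHom
  refine exists_extension i (fun r m => ⟨toGlobal (𝟙 _) r • m, hsmul r m⟩) (p ^ e) (fun f => ?_) φ fun r m m' h => ?_
  · obtain ⟨a, b, hb, rfl⟩ := IsFractionRing.div_surjective (A := R) f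
    have hb0 := nonZeroDivisors.ne_zero hb
    have hb1 : algebraMap R Y.functionField b ≠ 0 :=
      (map_ne_zero_iff _ (IsFractionRing.injective R Y.functionField)).mpr hb0
    refine ⟨b, hb0, ⟨toFunctionField (𝟙 _) (b ^ (p ^ e - 1) * a),
      toFunctionField_id_mem_globalSections (zero_le_ceil hΔ e) _⟩, ?_⟩
    refine (functionFieldMap_toFunctionField π _).trans ?_
    change algebraMap R Y.functionField _ = _
    have h1 : p ^ e = p ^ e - 1 + 1 := (Nat.sub_add_cancel (Nat.pow_pos hp.pos)).symm
    conv_rhs => rw [h1]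
    rw [map_mul, map_pow, pow_succ]
    field_simp
  · rw [← hφ]
    congr 1
    refine Subtype.ext (hinj ?_)
    rw [hsmul, map_pow]
    exact h

omit [CharP k p] [Algebra k R] [Algebra.EssFiniteType k R] in
/-- For the rational function `π^* h` corresponding to a `p⁻ᵉ`-linear map
`φ : R(⌈(pᵉ - 1)Δ⌉) → R` one has `div h ≥ (pᵉ - 1)(K_X + Δ)` on `X`. -/
theorem IsCartierOperator.mul_add_le_ord [Algebra k Y.functionField]
    [Algebra.EssFiniteType k Y.functionField] [CharP Y.functionField p]
    {C : TopForms k Y.functionField →+ TopForms k Y.functionField} (hC : IsCartierOperator p C)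
    {ω : TopForms k Y.functionField} (hω : ω ≠ 0)
    (hKY : ∀ y : PrimeDivisor Y, ∃ (η : TopForms k Y.functionField) (g : Y.functionField),
      IsGenerator k Y.functionField (Y.presheaf.stalk y.1) η ∧ g ≠ 0 ∧ ω = g • η ∧
        Scheme.ord g y.1 = KY y)
    (hpush : ∀ x, pushforwardDivisor π KY x = KX x) (hΔ : 0 ≤ Δ) (e : ℕ)
    (φ : globalSections (Spec (CommRingCat.of R)) (fun x => ⌈((p : ℚ) ^ e - 1) * Δ x⌉) →+ R)
    {Φ : Y.functionField →+ Y.functionField} (hΦl : ∀ r x, Φ (r ^ p ^ e * x) = r * Φ x)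
    (hΦφ : ∀ m, Φ ((functionFieldMap π).hom m.1) = toFunctionField π (φ m))
    {h : (Spec (CommRingCat.of R)).functionField} (hh : h ≠ 0)
    (hΦ : ∀ f, Φ f • ω = C^[e] ((f * (functionFieldMap π).hom h) • ω))
    (x : PrimeDivisor (Spec (CommRingCat.of R))) :
    ((p : ℚ) ^ e - 1) * (KX x + Δ x) ≤ Scheme.ord h x.1 := by
  have hp : p.Prime := Fact.out
  have hinj := functionFieldMap_injective π
  obtain ⟨x, hx⟩ := x
  obtain ⟨y, rfl, hy⟩ := exists_coheight_eq_one π hx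
  obtain ⟨η, g, hη, hg, hωη, hgK⟩ := hKY ⟨y, hy⟩
  have h1 := hC.le_ord e hΦ hω ((map_ne_zero_iff _ hinj).mpr hh) hy hη hg hωη
    (n := ⌈((p : ℚ) ^ e - 1) * Δ ⟨π y, hx⟩⌉) (by
      intro v hv0 hv hΦv
      obtain ⟨v, rfl⟩ := functionFieldMap_surjective π v
      have hv0' : v ≠ 0 := (map_ne_zero_iff _ hinj).mp hv0
      rw [ord_functionFieldMap π hy hx hv0'] at hv
      obtain ⟨t, ht, htv⟩ := exists_mul_mem_globalSections
        (fun x => ⌈((p : ℚ) ^ e - 1) * Δ x⌉) (zero_le_ceil hΔ e) ⟨π y, hx⟩ hv0' hv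
      have ht0 : t ≠ 0 := fun h => ht (h ▸ zero_mem _)
      -- with `t ^ pᵉ` as denominator, `Φ v = φ (t ^ pᵉ v) / t`, where `t` is a unit at `x`
      have htq : toFunctionField (𝟙 (Spec (CommRingCat.of R))) t ^ p ^ e * v ∈
          globalSections (Spec (CommRingCat.of R)) (fun x => ⌈((p : ℚ) ^ e - 1) * Δ x⌉) := by
        have h2 := Submodule.smul_mem _
          (toGlobal (𝟙 (Spec (CommRingCat.of R))) (t ^ (p ^ e - 1))) htv
        rw [Algebra.smul_def] at h2
        change toFunctionField _ _ * _ ∈ _ at h2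
        rwa [map_pow, ← mul_assoc, ← pow_succ, Nat.sub_add_cancel (Nat.pow_pos hp.pos)] at h2
      have h3 := hΦφ ⟨_, htq⟩
      rw [map_mul, map_pow, functionFieldMap_toFunctionField, hΦl] at h3
      have ht1 : toFunctionField π t ≠ 0 :=
        (map_ne_zero_iff _ (toFunctionField_injective π)).mpr ht0
      have h4 : Scheme.ord (toFunctionField π t) y = 0 := by
        rw [← functionFieldMap_toFunctionField,
          ord_functionFieldMap π hy hx (toFunctionField_id_ne_zero ht0)]
        exact (ord_toFunctionField_id_eq_zero_iff hx ht0).mpr ht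
      have h5 : φ ⟨_, htq⟩ ≠ 0 := fun h => by
        rw [h, map_zero] at h3
        exact mul_ne_zero ht1 hΦv h3
      have h6 := ord_toFunctionField_nonneg π hy h5
      rw [← h3, Scheme.ord_mul ht1 hΦv, h4] at h6
      omega)
  rw [ord_functionFieldMap π hy hx hh, hgK, ← pushforwardDivisor_apply π KY ⟨y, hy⟩ hx,
    hpush] at h1
  have h2 := Int.le_ceil (((p : ℚ) ^ e - 1) * Δ ⟨π y, hx⟩)
  have h3 : ((p : ℚ) ^ e - 1) * KX ⟨π y, hx⟩ + ⌈((p : ℚ) ^ e - 1) * Δ ⟨π y, hx⟩⌉ ≤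
      Scheme.ord h (π y) := by exact_mod_cast h1
  linarith

/-- The ideal of `R` defined by `π_* 𝒪_Y(⌈K_Y - π^*(K_X + Δ)⌉ + G)` is uniformly
`(Δ, F)`-compatible as soon as `G` is effective. -/
theorem isUniformlyFCompatible_pushforwardIdeal
    (hKY : IsCanonicalDivisor (π ≫ Spec.map (CommRingCat.ofHom (algebraMap k R))) KY)
    (hpush : ∀ x, pushforwardDivisor π KY x = KX x) (hΔ : 0 ≤ Δ)
    (hQC : IsQCartier (fun x => (KX x : ℚ) + Δ x)) (G : PrimeDivisor Y → ℤ) (hG : ∀ y, 0 ≤ G y) :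
    IsUniformlyFCompatible p Δ
      (pushforwardIdeal π (fun y => roundedDiscrepancy π KY KX Δ y + G y)) := by
  intro e he φ hφ r hr m hm
  have hp : p.Prime := Fact.out
  have hinj := functionFieldMap_injective π
  let := functionFieldAlgebra (π ≫ Spec.map (CommRingCat.ofHom (algebraMap k R)))
  have : Algebra.EssFiniteType k Y.functionField := essFiniteType_functionField k π
  have : CharP Y.functionField p :=
    charP_of_injective_algebraMap (algebraMap k Y.functionField).injective p
  obtain ⟨ω, hω, hKY⟩ := hKY
  obtain ⟨C, hC⟩ := exists_isCartierOperator k Y.functionField p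
  obtain ⟨Φ, hΦl, hΦφ⟩ := exists_extension_functionField π hΔ e φ hφ
  obtain ⟨h, hΦ⟩ := hC.exists_iterate_smul_eq hω e Φ hΦl
  obtain ⟨h, rfl⟩ := functionFieldMap_surjective π h
  have hm' : Φ (toFunctionField π r) = toFunctionField π (φ m) := by
    rw [← hΦφ, hm, ← functionFieldMap_toFunctionField]
    rfl
  change toFunctionField π (φ m) ∈ globalSections Y _
  rw [← hm']
  intro hΦ0 y
  have hr0 : toFunctionField π r ≠ 0 := fun h => hΦ0 (by rw [h, map_zero])
  have hh : h ≠ 0 := by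
    rintro rfl
    have h1 := hΦ (toFunctionField π r)
    rw [map_zero, mul_zero, zero_smul, iterate_map_zero] at h1
    exact (smul_ne_zero hΦ0 hω) h1
  obtain ⟨η, g, hη, hg, hωη, hgK⟩ := hKY y
  have hq : 1 ≤ p ^ e := Nat.pow_pos hp.pos
  have h1 := mul_pullbackQCartier_le_ord π hQC hh (p ^ e - 1) (fun x => by
    push_cast [hq]
    exact hC.mul_add_le_ord π hω hKY hpush hΔ e φ hΦl hΦφ hh hΦ x) y
  push_cast [hq] at h1
  have hry : toFunctionField π r ∈
      globalSections Y (fun y => roundedDiscrepancy π KY KX Δ y + G y) := hr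
  have h2 := hry hr0 y
  have h3 : (KY y : ℚ) - pullbackQCartier π (fun x => (KX x : ℚ) + Δ x) y ≤
      (roundedDiscrepancy π KY KX Δ y : ℤ) := Int.le_ceil _
  have h4 : (0 : ℚ) ≤ (G y : ℤ) := by exact_mod_cast hG y
  have h5 : (0 : ℚ) ≤ (p : ℚ) ^ e - 1 := by
    have : (1 : ℚ) ≤ (p : ℚ) ^ e := by exact_mod_cast hq
    linarith
  have h6 := hC.le_ord_apply e hΦ hω ((map_ne_zero_iff _ hinj).mpr hh) y.2 hη hg hωη
    (b := roundedDiscrepancy π KY KX Δ y + G y) hr0 hΦ0 (by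
      rw [hgK]
      have h7 : (0 : ℚ) ≤ Scheme.ord (toFunctionField π r) y.1 +
          (roundedDiscrepancy π KY KX Δ y + G y) := by exact_mod_cast h2
      have h8 : (p : ℚ) ^ e * (KY y - (roundedDiscrepancy π KY KX Δ y + G y)) ≤
          Scheme.ord (toFunctionField π r) y.1 +
            Scheme.ord ((functionFieldMap π).hom h) y.1 + KY y := by
        have h9 := mul_le_mul_of_nonneg_left (add_le_add h3 h4) h5
        linarith
      exact_mod_cast h8)
  change 0 ≤ _ + (roundedDiscrepancy π KY KX Δ y + G y)
  omega

theorem roundedDiscrepancy_eq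
    (hpush : ∀ x, pushforwardDivisor π KY x = KX x)
    (hQC : IsQCartier (fun x => (KX x : ℚ) + Δ x)) (y : PrimeDivisor Y)
    (hx : coheight (π y.1) = 1) :
    roundedDiscrepancy π KY KX Δ y = ⌈-Δ ⟨π y.1, hx⟩⌉ := by
  rw [roundedDiscrepancy, pullbackQCartier_eq π hQC y hx, ← hpush,
    pushforwardDivisor_apply π KY y hx, sub_add_cancel_left]

/-- If the coefficients of `D` at the prime divisors of `Y` that are not exceptional are at most
zero, then `π_* 𝒪_Y(D) ⊆ 𝒪_X`. -/
theorem pushforwardIsIdeal_of_nonpos {D : PrimeDivisor Y → ℤ}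
    (hD : ∀ y : PrimeDivisor Y, coheight (π y.1) = 1 → D y ≤ 0) : PushforwardIsIdeal π D := by
  intro f hf
  obtain ⟨f, rfl⟩ := functionFieldMap_surjective π f
  obtain ⟨r, rfl⟩ := mem_range_toFunctionField_id f (by
    rintro hf0 ⟨x, hx⟩
    obtain ⟨y, rfl, hy⟩ := exists_coheight_eq_one π hx
    have h1 := hf ((map_ne_zero_iff _ (functionFieldMap_injective π)).mpr hf0) ⟨y, hy⟩
    have h2 := hD ⟨y, hy⟩ hx
    rw [ord_functionFieldMap π hy hx hf0] at h1
    change 0 ≤ Scheme.ord f (π y)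
    omega)
  exact ⟨r, functionFieldMap_toFunctionField π r⟩

end Compatible

end FCompat

open FCompat in
theorem mainTheorem10 (p : ℕ) [Fact p.Prime]
    -- a perfect field of characteristic `p`
    (k : Type u) [Field k] [CharP k p] [PerfectField k]
    -- a regular ring essentially of finite type over `k`, and a normal domain which is a quotient
    (S : Type u) [CommRing S] [IsRegularRing S] [Algebra k S] [Algebra.EssFiniteType k S]
    (R : Type u) [CommRing R] [IsDomain R] [IsNoetherianRing R] [IsIntegrallyClosed R]
    [Algebra k R] [Algebra S R] [IsScalarTower k S R]
    (hSR : Function.Surjective (algebraMap S R))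
    -- a proper birational morphism from a normal scheme
    (Y : Scheme.{u}) [IsIntegral Y] [IsLocallyNoetherian Y] [IsNormalScheme Y]
    (π : Y ⟶ Spec (CommRingCat.of R)) [IsProper π] [IsBirational π]
    -- canonical divisors with `π_* K_Y = K_X`
    (KX : WeilDivisor (Spec (CommRingCat.of R)) ℤ) (KY : WeilDivisor Y ℤ)
    (hKX : IsCanonicalDivisor (Spec.map (CommRingCat.ofHom (algebraMap k R))) KX)
    (hKY : IsCanonicalDivisor (π ≫ Spec.map (CommRingCat.ofHom (algebraMap k R))) KY)
    (hpush : ∀ x, pushforwardDivisor π KY x = KX x)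
    -- an effective divisor such that `K_X + Δ` is `ℚ`-Cartier
    (Δ : WeilDivisor (Spec (CommRingCat.of R)) ℚ) (hΔ : 0 ≤ Δ)
    (hQC : IsQCartier (fun x => (KX x : ℚ) + Δ x)) :
    -- the ideals given by effective integral divisors are uniformly compatible
    (∀ G : WeilDivisor Y ℤ, 0 ≤ G →
      PushforwardIsIdeal π (fun y => roundedDiscrepancy π KY KX Δ y + G y) →
      IsUniformlyFCompatible p Δ
        (pushforwardIdeal π (fun y => roundedDiscrepancy π KY KX Δ y + G y))) ∧
    -- exceptional effective divisors always give ideals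
    (∀ G : WeilDivisor Y ℤ, 0 ≤ G → IsExceptional π G →
      PushforwardIsIdeal π (fun y => roundedDiscrepancy π KY KX Δ y + G y)) ∧
    -- multiplier ideals
    (PushforwardIsIdeal π (roundedDiscrepancy π KY KX Δ) ∧
      IsUniformlyFCompatible p Δ (pushforwardIdeal π (roundedDiscrepancy π KY KX Δ))) ∧
    -- adjoint ideals along a reduced divisor `D ≤ Δ`
    (∀ D : WeilDivisor (Spec (CommRingCat.of R)) ℤ, (∀ x, D x = 0 ∨ D x = 1) →
      (∀ x, (D x : ℚ) ≤ Δ x) →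
      PushforwardIsIdeal π
        (fun y => roundedDiscrepancy π KY KX Δ y + strictTransform π D y) ∧
      IsUniformlyFCompatible p Δ
        (pushforwardIdeal π
          (fun y => roundedDiscrepancy π KY KX Δ y + strictTransform π D y))) := by
  have hR : Algebra.EssFiniteType k R := by
    have : Algebra.FiniteType S R := Algebra.FiniteType.of_surjective (Algebra.ofId S R) hSR
    exact Algebra.EssFiniteType.comp k S R
  have hle : ∀ (y : PrimeDivisor Y) (hx : coheight (π y.1) = 1),
      roundedDiscrepancy π KY KX Δ y ≤ 0 := fun y hx => by
    rw [roundedDiscrepancy_eq π hpush hQC y hx]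
    exact Int.ceil_le.mpr (by simpa using hΔ ⟨π y.1, hx⟩)
  have hcompat := isUniformlyFCompatible_pushforwardIdeal (p := p) π hKY hpush hΔ hQC
  have hstrict : ∀ {D : WeilDivisor (Spec (CommRingCat.of R)) ℤ} (y : PrimeDivisor Y)
      (hx : coheight (π y.1) = 1), strictTransform π D y = D ⟨π y.1, hx⟩ :=
    fun y hx => dif_pos hx
  refine ⟨fun G hG _ => hcompat G hG, fun G _ hGe => ?_, ⟨?_, ?_⟩, fun D hD hDΔ => ⟨?_, ?_⟩⟩
  · refine pushforwardIsIdeal_of_nonpos π fun y hx => ?_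
    have hG0 : G y = 0 := by
      by_contra h
      have := hGe y h
      rw [hx] at this
      exact absurd this (by decide)
    rw [hG0, add_zero]
    exact hle y hx
  · exact pushforwardIsIdeal_of_nonpos π hle
  · simpa using hcompat (fun _ => 0) fun _ => le_rfl
  · refine pushforwardIsIdeal_of_nonpos π fun y hx => ?_
    -- `D ≤ Δ` and `D` is integral, so `⌈-Δ⌉ ≤ -D`
    have h1 : ⌈-Δ ⟨π y.1, hx⟩⌉ ≤ -D ⟨π y.1, hx⟩ :=
      Int.ceil_le.mpr (by push_cast; exact neg_le_neg (hDΔ _))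
    rw [roundedDiscrepancy_eq π hpush hQC y hx, hstrict y hx]
    omega
  · refine hcompat _ fun y => ?_
    by_cases hx : coheight (π y.1) = 1
    · rw [hstrict y hx]
      have := hD ⟨π y.1, hx⟩
      omega
    · exact (show strictTransform π D y = 0 from dif_neg hx).ge
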